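/- For $n\le m$, represent a point of the real Grassmannian $\mathrm{Gr}(n,m)$ by its $n\times m$ matrix $A$ in reduced row echelon form (RREF) of rank $n$, with columns $v_1,\dots,v_m$. For an $n$-subset $I$ of columns let $\Delta_I(A)$ be the corresponding maximal minor; $A\in\mathrm{Gr}(n,m)_{\ge 0}$ ($A$ is totally nonnegative, TNN) means that $\Delta_I(A)\ge 0$ for all $I$. The permutation $\pi(A)\in S_m$ is defined by: $\pi(A)(i)=j$, where $j$ is the first index met in going cyclically backwards $i-1,i-2,\dots,i$ (indices mod $m$) with $v_i\in\mathrm{span}(v_j,v_{j+1},\dots,v_{i-1})$, and $\pi(A)(i)=i$ if $v_i=0$. (It is a derangement exactly when $A$ is irreducible, i.e. has no zero column and no row whose only nonzero entry is its pivot.) Let $A_1\in\mathrm{Gr}(n_1,m_1)_{\ge0}$ and $A_2\in\mathrm{Gr}(n_2,m_2)_{\ge 0}$ have columns labelled by real parameters $\kappa^{(1)}_1<\dots<\kappa^{(1)}_{m_1}$ and $\kappa^{(2)}_1<\dots<\kappa^{(2)}_{m_2}$, all $M=m_1+m_2$ of them distinct, and put $N=n_1+n_2$. Let $\phi$ denote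 the position of a parameter in the increasing ordering of all $M$ parameters. The $\kappa$-direct sum $A_1\hat\oplus A_2$ is the $N\times M$ matrix obtained from the block-diagonal matrix with blocks $A_1,A_2$ by ordering the columns by increasing parameter and then the rows by increasing pivot, so that it is in RREF. In the chord diagram of $\pi(A_k)$, a chord joins $\kappa^{(k)}_i$ and $\kappa^{(k)}_{\pi(A_k)(i)}$, drawn above the line if $i<\pi(A_k)(i)$ and below it if $i>\pi(A_k)(i)$; $A_1$ and $A_2$ are non-crossing if no chord of $\pi(A_1)$ crosses a chord of $\pi(A_2)$ on the same side of the line. **Proposition.** If $A_1$ and $A_2$ are non-crossing, then there are RREF matrices $B_1,B_2$, obtained from $A_1,A_2$ by changing the signs of some nonzero entries, such that $B:=B_1\hat\oplus B_2$ satisfies: 1. $B\in\mathrm{Gr}(N,M)_{\ge 0}$; 2. $\pi(B)=\pi(A_1)\cdot\pi(A_2)$ in $S_M$, where $\pi(A_1)$ and $\pi(A_2)$ are regarded as permutations of disjoint subsets of $\{1,\dots,M\}$ through $\phi$; 3. $\Delta_I(B)=|\Delta_I(A_1\hat\oplus A_2)|$ for every $N$-subset $I$ of $\{1,\dots,M\}$,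 and $B$ is the only element of $\mathrm{Gr}(N,M)_{\ge0}$ (in RREF) whose maximal minors agree in absolute value with those of $A_1\hat\oplus A_2$. -/

import Mathlib

/-- `A` is in reduced row echelon form of full rank, `p i` being the pivot column of row `i`.
Such matrices are the canonical representatives of the points of the real Grassmannian
`Gr(n, m)` (the point is the row space of `A`). -/
def IsRREF {n m : ℕ} (A : Matrix (Fin n) (Fin m) ℝ) : Prop :=
  ∃ p : Fin n → Fin m, StrictMono p ∧
    (∀ i j, j < p i → A i j = 0) ∧ (∀ i i', A i (p i') = if i = i' then 1 else 0)

/-- The maximal minor `Δ_I(A)`; the `n`-element set of columns `I` is given by its increasing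
enumeration. -/
def maximalMinor {n m : ℕ} (A : Matrix (Fin n) (Fin m) ℝ) (I : Fin n ↪o Fin m) : ℝ :=
  (A.submatrix id I).det

/-- `A` (in reduced row echelon form) represents a point of the totally nonnegative
Grassmannian `Gr(n, m)_{≥ 0}`: all its maximal minors are nonnegative. -/
def MemTNNGrassmannian {n m : ℕ} (A : Matrix (Fin n) (Fin m) ℝ) : Prop :=
  IsRREF A ∧ ∀ I : Fin n ↪o Fin m, 0 ≤ maximalMinor A I

/-- The span of the `d` columns of `A` that cyclically precede column `i`, that is, of the
columns `i - 1, …, i - d` modulo `m`. -/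
def precedingSpan {n m : ℕ} (A : Matrix (Fin n) (Fin m) ℝ) (i : Fin m) (d : ℕ) :
    Submodule ℝ (Fin n → ℝ) :=
  Submodule.span ℝ ((fun k : ℕ => A.col (((finRotate m)⁻¹ ^ k) i)) '' Set.Icc 1 d)

theorem finRotate_pow_self {m : ℕ} (i : Fin m) : ((finRotate m)⁻¹ ^ m) i = i := by
  have h : (finRotate m) ^ m = 1 := by
    rcases m with _ | _ | m
    · rfl
    · ext j
      have : j = 0 := Fin.fin_one_eq_zero j
      simp [this]
    · have h1 := pow_orderOf_eq_one (finRotate (m + 2))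
      have h2 : orderOf (finRotate (m + 2)) = m + 2 := by
        rw [Equiv.Perm.IsCycle.orderOf isCycle_finRotate, support_finRotate]
        simp
      rwa [h2] at h1
  rw [inv_pow, h]
  simp

theorem exists_mem_precedingSpan {n m : ℕ} (A : Matrix (Fin n) (Fin m) ℝ) (i : Fin m) :
    ∃ d, A.col i ∈ precedingSpan A i d := by
  refine ⟨m, Submodule.subset_span ⟨m, ⟨?_, le_rfl⟩, ?_⟩⟩
  · exact Nat.succ_le_of_lt (Fin.pos i)
  · simp only [finRotate_pow_self]

open Classical in
/-- The least number `d` of cyclically preceding columns whose span contains column `i`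
(it is `0` exactly for a zero column, and at most `m`). -/
noncomputable def spanDepth {n m : ℕ} (A : Matrix (Fin n) (Fin m) ℝ) (i : Fin m) : ℕ :=
  Nat.find (exists_mem_precedingSpan A i)

theorem spanDepth_mem {n m : ℕ} (A : Matrix (Fin n) (Fin m) ℝ) (i : Fin m) :
    A.col i ∈ precedingSpan A i (spanDepth A i) := by
  classical
  exact Nat.find_spec (exists_mem_precedingSpan A i)

theorem spanDepth_le {n m : ℕ} (A : Matrix (Fin n) (Fin m) ℝ) (i : Fin m) {d : ℕ}
    (h : A.col i ∈ precedingSpan A i d) : spanDepth A i ≤ d := by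
  classical
  exact Nat.find_min' (exists_mem_precedingSpan A i) h

theorem spanDepth_injective_aux {n m : ℕ} (A : Matrix (Fin n) (Fin m) ℝ) (i i' : Fin m)
    (h : ((finRotate m)⁻¹ ^ spanDepth A i) i = ((finRotate m)⁻¹ ^ spanDepth A i') i')
    (hlt : spanDepth A i < spanDepth A i') : False := by
  set d := spanDepth A i with hd
  set d' := spanDepth A i' with hd'
  set σ := (finRotate m)⁻¹ with hσ
  obtain ⟨e, he⟩ : ∃ e, d' = d + e := ⟨d' - d, by omega⟩
  have hi : i = (σ ^ e) i' := by
    rw [he, pow_add, Equiv.Perm.mul_apply] at h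
    exact (σ ^ d).injective h
  have hk : ∀ k, (σ ^ k) i = (σ ^ (k + e)) i' := by
    intro k
    rw [pow_add, Equiv.Perm.mul_apply, ← hi]
  -- the common image column lies in the span of the columns strictly between it and `i'`
  have key : A.col ((σ ^ d') i') ∈ precedingSpan A i' (d' - 1) := by
    have hm := spanDepth_mem A i
    rw [← hd] at hm
    rcases Nat.eq_zero_or_pos d with h0 | hpos
    · rw [h0] at hm
      have : A.col i = 0 := by simpa [precedingSpan] using hm
      rw [← h, h0]
      simp [this]
    · have hnot : A.col i ∉ precedingSpan A i (d - 1) := by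
        intro hc
        have := spanDepth_le A i hc
        omega
      have hsplit : precedingSpan A i d = Submodule.span ℝ (insert (A.col ((σ ^ d) i))
          ((fun k : ℕ => A.col ((σ ^ k) i)) '' Set.Icc 1 (d - 1))) := by
        rw [precedingSpan, ← Set.image_insert_eq (f := fun k : ℕ => A.col ((σ ^ k) i))]
        congr 2
        ext k
        simp only [Set.mem_Icc, Set.mem_insert_iff]
        omega
      rw [hsplit] at hm
      have hx := mem_span_insert_exchange hm hnot
      rw [← h]
      refine Submodule.span_mono ?_ hx
      rintro v (rfl | ⟨k, ⟨hk1, hk2⟩, rfl⟩)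
      · refine ⟨e, ⟨by omega, by omega⟩, ?_⟩
        show A.col ((σ ^ e) i') = _
        rw [← hi]
      · refine ⟨k + e, ⟨by omega, by omega⟩, ?_⟩
        show A.col ((σ ^ (k + e)) i') = A.col ((σ ^ k) i)
        rw [hk]
  have hm' := spanDepth_mem A i'
  rw [← hd'] at hm'
  have hle : precedingSpan A i' d' ≤ precedingSpan A i' (d' - 1) := by
    refine Submodule.span_le.2 ?_
    rintro v ⟨k, ⟨hk1, hk2⟩, rfl⟩
    rcases Nat.lt_or_ge k d' with hk3 | hk3
    · exact Submodule.subset_span ⟨k, ⟨hk1, by omega⟩, rfl⟩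
    · have hkd : k = d' := by omega
      rw [hkd]
      exact key
  have := spanDepth_le A i' (hle hm')
  omega

theorem soliton_map_injective {n m : ℕ} (A : Matrix (Fin n) (Fin m) ℝ) :
    Function.Injective (fun i => ((finRotate m)⁻¹ ^ spanDepth A i) i) := by
  intro i i' h
  simp only at h
  rcases lt_trichotomy (spanDepth A i) (spanDepth A i') with hlt | heq | hgt
  · exact (spanDepth_injective_aux A i i' h hlt).elim
  · rw [heq] at h
    exact (((finRotate m)⁻¹ ^ spanDepth A i').injective h)
  · exact (spanDepth_injective_aux A i' i h.symm hgt).elim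

/-- The permutation `π(A)`: `π(A) i = j` when `j` is the first column, going cyclically backwards
`i - 1, i - 2, …` from column `i`, such that column `i` is in the span of the columns
`j, j + 1, …, i - 1` (indices modulo `m`); a zero column is a fixed point. Pivot columns satisfy
`i ≤ π(A) i` and non-pivot columns `π(A) i ≤ i`. The permutation has no fixed point exactly when
`A` is irreducible (no zero column, and no row that is zero outside its pivot). -/
noncomputable def tnnPerm {n m : ℕ} (A : Matrix (Fin n) (Fin m) ℝ) : Equiv.Perm (Fin m) :=
  Equiv.ofBijective (fun i => ((finRotate m)⁻¹ ^ spanDepth A i) i)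
    (Finite.injective_iff_bijective.1 (soliton_map_injective A))

/-- Two chords with end points `a < b` and `c < d` on the line, drawn on the same side of the
line, cross. -/
def ChordsCross (a b c d : ℝ) : Prop :=
  (a < c ∧ c < b ∧ b < d) ∨ (c < a ∧ a < d ∧ d < b)

/-- The chord diagrams of the permutations `π₁`, `π₂` of points labelled by the parameters `κ₁`,
`κ₂` on a common line have no crossing chords between the two permutations: exceedances
`i < π i` are drawn as chords above the line and deficiencies `π i < i` below it. -/
def NonCrossing {m₁ m₂ : ℕ} (κ₁ : Fin m₁ → ℝ) (π₁ : Equiv.Perm (Fin m₁))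
    (κ₂ : Fin m₂ → ℝ) (π₂ : Equiv.Perm (Fin m₂)) : Prop :=
  (∀ i j, i < π₁ i → j < π₂ j → ¬ ChordsCross (κ₁ i) (κ₁ (π₁ i)) (κ₂ j) (κ₂ (π₂ j))) ∧
  (∀ i j, π₁ i < i → π₂ j < j → ¬ ChordsCross (κ₁ (π₁ i)) (κ₁ i) (κ₂ (π₂ j)) (κ₂ j))

/-- The permutation that sorts the concatenated list of parameters `κ₁, κ₂` increasingly: it sends
a position in the sorted list to the position of the same parameter in the concatenated list. -/
noncomputable def kappaSort {m₁ m₂ : ℕ} (κ₁ : Fin m₁ → ℝ) (κ₂ : Fin m₂ → ℝ) :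
    Equiv.Perm (Fin (m₁ + m₂)) :=
  Tuple.sort (Fin.append κ₁ κ₂)

/-- The map `φ` on the first set of parameters: the position of `κ₁ j` in the sorted list of all
parameters. -/
noncomputable def kappaPosLeft {m₁ m₂ : ℕ} (κ₁ : Fin m₁ → ℝ) (κ₂ : Fin m₂ → ℝ) :
    Fin m₁ ↪ Fin (m₁ + m₂) :=
  (Fin.castAddEmb m₂).trans (kappaSort κ₁ κ₂).symm.toEmbedding

/-- The map `φ` on the second set of parameters: the position of `κ₂ j` in the sorted list of all
parameters. -/
noncomputable def kappaPosRight {m₁ m₂ : ℕ} (κ₁ : Fin m₁ → ℝ) (κ₂ : Fin m₂ → ℝ) :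
    Fin m₂ ↪ Fin (m₁ + m₂) :=
  (Fin.natAddEmb m₁).trans (kappaSort κ₁ κ₂).symm.toEmbedding

/-- The product `π₁ · π₂` in the symmetric group of all the sorted parameters, where each factor is
transported along `φ` and fixes the points that belong to the other factor. -/
noncomputable def kappaPermProd {m₁ m₂ : ℕ} (κ₁ : Fin m₁ → ℝ) (κ₂ : Fin m₂ → ℝ)
    (π₁ : Equiv.Perm (Fin m₁)) (π₂ : Equiv.Perm (Fin m₂)) : Equiv.Perm (Fin (m₁ + m₂)) :=
  π₁.viaFintypeEmbedding (kappaPosLeft κ₁ κ₂) * π₂.viaFintypeEmbedding (kappaPosRight κ₁ κ₂)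

open Classical in
/-- The number of leading zeros of row `i`. -/
noncomputable def leadingZeros {n m : ℕ} (X : Matrix (Fin n) (Fin m) ℝ) (i : Fin n) : ℕ :=
  (Finset.univ.filter fun c : Fin m => ∀ c' ≤ c, X i c' = 0).card

/-- The block-diagonal matrix of `A₁` and `A₂` with its columns rearranged in the increasing order
of the parameters. -/
noncomputable def kappaBlock {n₁ n₂ m₁ m₂ : ℕ} (κ₁ : Fin m₁ → ℝ) (κ₂ : Fin m₂ → ℝ)
    (A₁ : Matrix (Fin n₁) (Fin m₁) ℝ) (A₂ : Matrix (Fin n₂) (Fin m₂) ℝ) :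
    Matrix (Fin (n₁ + n₂)) (Fin (m₁ + m₂)) ℝ :=
  ((Matrix.fromBlocks A₁ 0 0 A₂).reindex finSumFinEquiv finSumFinEquiv).submatrix id
    (kappaSort κ₁ κ₂)

/-- The `κ`-direct sum: the columns of the block-diagonal matrix of `A₁` and `A₂` are put in the
increasing order of the parameters, and then the rows are put in the increasing order of their
pivots, so that the result is in reduced row echelon form when `A₁` and `A₂` are. -/
noncomputable def kappaDirectSum {n₁ n₂ m₁ m₂ : ℕ} (κ₁ : Fin m₁ → ℝ) (κ₂ : Fin m₂ → ℝ)
    (A₁ : Matrix (Fin n₁) (Fin m₁) ℝ) (A₂ : Matrix (Fin n₂) (Fin m₂) ℝ) :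
    Matrix (Fin (n₁ + n₂)) (Fin (m₁ + m₂)) ℝ :=
  (kappaBlock κ₁ κ₂ A₁ A₂).submatrix
    (Tuple.sort (leadingZeros (kappaBlock κ₁ κ₂ A₁ A₂))) id

/-- `B` is obtained from `A` by changing the signs of some of its entries, and it is still in
reduced row echelon form (so that the pivots remain `1`). -/
def IsSignAdjustment {n m : ℕ} (B A : Matrix (Fin n) (Fin m) ℝ) : Prop :=
  IsRREF B ∧ ∀ i j, |B i j| = |A i j|

/-- The cyclic interval `[j, i - 1]` of columns, which is everything when `j = i`. -/
def backArc {m : ℕ} (j i : Fin m) : Set (Fin m) :=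
  {x | (j < i ∧ j ≤ x ∧ x < i) ∨ (i ≤ j ∧ (j ≤ x ∨ x < i))}

theorem finRotate_inv_val {m : ℕ} (x : Fin m) :
    ((finRotate m)⁻¹ x).val = if x.val = 0 then m - 1 else x.val - 1 := by
  obtain ⟨y, rfl⟩ := (finRotate m).surjective x
  have hy : (finRotate m)⁻¹ (finRotate m y) = y := (finRotate m).symm_apply_apply y
  rw [hy]
  rcases m with _ | m
  · exact y.elim0
  · rw [coe_finRotate]
    have := y.2
    by_cases h : y = Fin.last m
    · simp [h]
    · simp [h]

theorem finRotate_inv_pow_val {m : ℕ} (i : Fin m) (k : ℕ) (hk : k ≤ m) :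
    (((finRotate m)⁻¹ ^ k) i).val = if k ≤ i.val then i.val - k else i.val + m - k := by
  induction k with
  | zero => simp
  | succ k ih =>
    rw [pow_succ', Equiv.Perm.mul_apply, finRotate_inv_val, ih (by omega)]
    have := i.2
    split_ifs <;> omega

theorem image_finRotate_inv_pow {m : ℕ} (i : Fin m) {d : ℕ} (hd : 1 ≤ d) (hdm : d ≤ m) :
    (fun k : ℕ => ((finRotate m)⁻¹ ^ k) i) '' Set.Icc 1 d
      = backArc (((finRotate m)⁻¹ ^ d) i) i := by
  have hi := i.2
  have hv := finRotate_inv_pow_val i d hdm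
  ext x
  have hx := x.2
  simp only [backArc, Set.mem_image, Set.mem_Icc, Set.mem_ofPred_eq, Fin.lt_def, Fin.le_def, hv]
  constructor
  · rintro ⟨k, ⟨h1, h2⟩, rfl⟩
    have hk := finRotate_inv_pow_val i k (by omega)
    rw [hk]
    split_ifs <;> omega
  · intro h
    by_cases hxi : x.val < i.val
    · refine ⟨i.val - x.val, ?_, ?_⟩
      · split_ifs at h <;> omega
      · apply Fin.ext
        rw [finRotate_inv_pow_val _ _ (by omega)]
        split_ifs <;> omega
    · refine ⟨i.val + m - x.val, ?_, ?_⟩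
      · split_ifs at h <;> omega
      · apply Fin.ext
        rw [finRotate_inv_pow_val _ _ (by omega)]
        split_ifs <;> omega

theorem spanDepth_le_self {n m : ℕ} (A : Matrix (Fin n) (Fin m) ℝ) (i : Fin m) :
    spanDepth A i ≤ m := by
  refine spanDepth_le A i (Submodule.subset_span ⟨m, ⟨?_, le_rfl⟩, ?_⟩)
  · exact Nat.succ_le_of_lt (Fin.pos i)
  · simp only [finRotate_pow_self]

theorem tnnPerm_apply {n m : ℕ} (A : Matrix (Fin n) (Fin m) ℝ) (i : Fin m) :
    tnnPerm A i = ((finRotate m)⁻¹ ^ spanDepth A i) i := rfl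

theorem precedingSpan_eq {n m : ℕ} (A : Matrix (Fin n) (Fin m) ℝ) (i : Fin m) {d : ℕ}
    (hd : 1 ≤ d) (hdm : d ≤ m) :
    precedingSpan A i d = Submodule.span ℝ (A.col '' backArc (((finRotate m)⁻¹ ^ d) i) i) := by
  rw [precedingSpan, ← image_finRotate_inv_pow i hd hdm, Set.image_image]

theorem tnnPerm_of_col_eq_zero {n m : ℕ} {A : Matrix (Fin n) (Fin m) ℝ} {i : Fin m}
    (h : A.col i = 0) : tnnPerm A i = i := by
  have : spanDepth A i = 0 := by
    have := spanDepth_le A i (d := 0) (by rw [h]; exact Submodule.zero_mem _)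
    omega
  rw [tnnPerm_apply, this]
  simp

theorem one_le_spanDepth {n m : ℕ} {A : Matrix (Fin n) (Fin m) ℝ} {i : Fin m}
    (h : A.col i ≠ 0) : 1 ≤ spanDepth A i := by
  by_contra hlt
  have h0 : spanDepth A i = 0 := by omega
  have := spanDepth_mem A i
  rw [h0] at this
  exact h (by simpa [precedingSpan] using this)

theorem col_mem_span_backArc_tnnPerm {n m : ℕ} (A : Matrix (Fin n) (Fin m) ℝ) (i : Fin m)  :
    A.col i ∈ Submodule.span ℝ (A.col '' backArc (tnnPerm A i) i) := by
  by_cases h : A.col i = 0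
  · rw [h]
    exact Submodule.zero_mem _
  · have := spanDepth_mem A i
    rwa [precedingSpan_eq A i (one_le_spanDepth h) (spanDepth_le_self A i)] at this

theorem col_notMem_span_backArc_diff_tnnPerm {n m : ℕ} {A : Matrix (Fin n) (Fin m) ℝ}
    {i : Fin m} (h : A.col i ≠ 0) :
    A.col i ∉ Submodule.span ℝ (A.col '' (backArc (tnnPerm A i) i \ {tnnPerm A i})) := by
  intro hmem
  have h1 := one_le_spanDepth h
  have hm := spanDepth_le_self A i
  have hsub : A.col i ∈ precedingSpan A i (spanDepth A i - 1) := by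
    refine Submodule.span_mono ?_ hmem
    rintro _ ⟨x, ⟨hx, hne⟩, rfl⟩
    rw [tnnPerm_apply, ← image_finRotate_inv_pow i h1 hm] at hx
    obtain ⟨k, ⟨hk1, hk2⟩, rfl⟩ := hx
    refine ⟨k, ⟨hk1, ?_⟩, rfl⟩
    have : k ≠ spanDepth A i := by
      rintro rfl
      exact hne rfl
    omega
  have := spanDepth_le A i hsub
  omega

theorem backArc_subset_diff_or {m : ℕ} (i : Fin m) {j j' : Fin m} (h : j ≠ j') :
    backArc j i ⊆ backArc j' i \ {j'} ∨ backArc j' i ⊆ backArc j i \ {j} := by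
  have h' : j.val ≠ j'.val := fun e => h (Fin.ext e)
  by_cases hc : (j'.val < j.val ∧ (j.val < i.val ∨ i.val ≤ j'.val)) ∨
    (j.val < i.val ∧ i.val ≤ j'.val)
  · left
    intro x hx
    simp only [backArc, Set.mem_ofPred_eq, Set.mem_sdiff, Set.mem_singleton_iff, Fin.lt_def,
      Fin.le_def, Fin.ext_iff] at hx ⊢
    omega
  · right
    intro x hx
    simp only [backArc, Set.mem_ofPred_eq, Set.mem_sdiff, Set.mem_singleton_iff, Fin.lt_def,
      Fin.le_def, Fin.ext_iff] at hx ⊢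
    omega

theorem tnnPerm_eq_of_mem_span {n m : ℕ} {A : Matrix (Fin n) (Fin m) ℝ} {i j : Fin m}
    (h1 : A.col i ∈ Submodule.span ℝ (A.col '' backArc j i))
    (h2 : A.col i ∉ Submodule.span ℝ (A.col '' (backArc j i \ {j}))) :
    tnnPerm A i = j := by
  have h0 : A.col i ≠ 0 := fun h => h2 (h ▸ Submodule.zero_mem _)
  by_contra hne
  rcases backArc_subset_diff_or i hne with h | h
  · exact h2 (Submodule.span_mono (Set.image_mono h) (col_mem_span_backArc_tnnPerm A i))
  · exact col_notMem_span_backArc_diff_tnnPerm h0 (Submodule.span_mono (Set.image_mono h) h1)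

/-- The spans of the columns of an order-convex set that is invariant under `π(A)` and of the
remaining columns are independent. -/
theorem disjoint_span_of_tnnPerm_invariant {n m : ℕ} (A : Matrix (Fin n) (Fin m) ℝ)
    (T : Set (Fin m)) (hT : T.OrdConnected) (hinv : ∀ i ∈ T, tnnPerm A i ∈ T) :
    Disjoint (Submodule.span ℝ (A.col '' T)) (Submodule.span ℝ (A.col '' Tᶜ)) := by
  have key : ∀ N : ℕ, ∀ w ∈ Submodule.span ℝ (A.col '' {k | k ∈ T ∧ k.val < N}),
      w ∈ Submodule.span ℝ (A.col '' Tᶜ) → w = 0 := by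
    intro N
    induction N with
    | zero =>
      intro w hw _
      simpa using hw
    | succ N ih =>
      intro w hw hw'
      by_cases hN : ∃ i : Fin m, i ∈ T ∧ i.val = N
      · obtain ⟨i, hiT, hiN⟩ := hN
        have hset : {k : Fin m | k ∈ T ∧ k.val < N + 1}
            = insert i {k : Fin m | k ∈ T ∧ k.val < N} := by
          ext k
          simp only [Set.mem_ofPred_eq, Set.mem_insert_iff, Fin.ext_iff]
          constructor
          · rintro ⟨h1, h2⟩
            by_cases h : k.val = i.val
            · exact Or.inl h
            · exact Or.inr ⟨h1, by omega⟩
          · rintro (h | ⟨h1, h2⟩)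
            · exact ⟨(Fin.ext h : k = i) ▸ hiT, by omega⟩
            · exact ⟨h1, by omega⟩
        have hv : A.col i ∈ Submodule.span ℝ (A.col '' {k | k ∈ T ∧ k.val < N}) ∨
            w ∈ Submodule.span ℝ (A.col '' {k | k ∈ T ∧ k.val < N}) := by
          rw [hset, Set.image_insert_eq, Submodule.mem_span_insert] at hw
          obtain ⟨a, u, hu, rfl⟩ := hw
          by_cases ha : a = 0
          · right
            simpa [ha] using hu
          · left
            have hmem : A.col i ∈ Submodule.span ℝ (A.col '' ({k | k ∈ T ∧ k.val < N} ∪ Tᶜ)) := by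
              have : A.col i = a⁻¹ • ((a • A.col i + u) - u) := by
                rw [add_sub_cancel_right, smul_smul, inv_mul_cancel₀ ha, one_smul]
              rw [this]
              refine Submodule.smul_mem _ _ (Submodule.sub_mem _ ?_ ?_)
              · exact Submodule.span_mono (Set.image_mono Set.subset_union_right) hw'
              · exact Submodule.span_mono (Set.image_mono Set.subset_union_left) hu
            by_cases hz : A.col i = 0
            · rw [hz]
              exact Submodule.zero_mem _
            have hlt : tnnPerm A i < i := by
              by_contra hge
              refine col_notMem_span_backArc_diff_tnnPerm hz
                (Submodule.span_mono (Set.image_mono ?_) hmem)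
              intro k hk
              have hπ := hinv i hiT
              have hconv : k.val < i.val ∨ (tnnPerm A i).val < k.val := by
                rcases hk with hk | hk
                · left
                  have := hk.2
                  omega
                · by_contra hcon
                  push Not at hcon
                  exact hk (hT.out hiT hπ ⟨hcon.1, hcon.2⟩)
              simp only [backArc, Set.mem_ofPred_eq, Set.mem_sdiff, Set.mem_singleton_iff,
                Fin.lt_def, Fin.le_def, Fin.ext_iff] at hge ⊢
              omega
            refine Submodule.span_mono (Set.image_mono ?_) (col_mem_span_backArc_tnnPerm A i)
            intro k hk
            have hk' : tnnPerm A i ≤ k ∧ k < i := by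
              rcases hk with hk | hk
              · exact hk.2
              · exact absurd hk.1 (not_le.2 hlt)
            exact ⟨hT.out (hinv i hiT) hiT ⟨hk'.1, hk'.2.le⟩, hiN ▸ hk'.2⟩
        refine ih w ?_ hw'
        rcases hv with hv | hv
        · rw [hset, Set.image_insert_eq, Submodule.span_insert_eq_span hv] at hw
          exact hw
        · exact hv
      · refine ih w (Submodule.span_mono (Set.image_mono ?_) hw) hw'
        rintro k ⟨h1, h2⟩
        refine ⟨h1, ?_⟩
        have : k.val ≠ N := fun h => hN ⟨k, h1, h⟩
        omega
  rw [Submodule.disjoint_def]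
  intro w hw hw'
  refine key m w (Submodule.span_mono (Set.image_mono ?_) hw) hw'
  intro k hk
  exact ⟨hk, k.2⟩

/-- A nonzero entry of a matrix in reduced row echelon form is not separated from its pivot by
an order-convex set that is invariant under `π(A)`. -/
theorem mem_iff_mem_of_tnnPerm_invariant {n m : ℕ} {A : Matrix (Fin n) (Fin m) ℝ}
    {p : Fin n → Fin m} (hp : ∀ i i', A i (p i') = if i = i' then 1 else 0)
    (T : Set (Fin m)) (hT : T.OrdConnected) (hinv : ∀ i ∈ T, tnnPerm A i ∈ T)
    {r : Fin n} {c : Fin m} (h : A r c ≠ 0) : p r ∈ T ↔ c ∈ T := by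
  have hdis := disjoint_span_of_tnnPerm_invariant A T hT hinv
  have hcolp : ∀ i, A.col (p i) = Pi.single i (1 : ℝ) := by
    intro i
    ext x
    simp [Matrix.col_apply, hp, Pi.single_apply]
  have main : ∀ U : Set (Fin m),
      Disjoint (Submodule.span ℝ (A.col '' U)) (Submodule.span ℝ (A.col '' Uᶜ)) →
      c ∈ U → p r ∈ U := by
    classical
    intro U hU hc
    by_contra hpr
    have hdecomp : A.col c = ∑ i, A i c • A.col (p i) := by
      ext x
      simp [hcolp, Finset.sum_apply, Pi.single_apply, Matrix.col_apply]
    rw [← Finset.sum_filter_add_sum_filter_not Finset.univ (fun i => p i ∈ U)] at hdecomp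
    have h1 : ∑ i with p i ∈ U, A i c • A.col (p i) ∈ Submodule.span ℝ (A.col '' U) := by
      refine Submodule.sum_mem _ fun i hi => Submodule.smul_mem _ _ (Submodule.subset_span ?_)
      exact ⟨p i, (Finset.mem_filter.1 hi).2, rfl⟩
    have h2 : ∑ i with p i ∉ U, A i c • A.col (p i) ∈ Submodule.span ℝ (A.col '' Uᶜ) := by
      refine Submodule.sum_mem _ fun i hi => Submodule.smul_mem _ _ (Submodule.subset_span ?_)
      exact ⟨p i, (Finset.mem_filter.1 hi).2, rfl⟩
    have h3 : ∑ i with p i ∉ U, A i c • A.col (p i) = 0 := by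
      refine Submodule.disjoint_def.1 hU _ ?_ h2
      have : ∑ i with p i ∉ U, A i c • A.col (p i)
          = A.col c - ∑ i with p i ∈ U, A i c • A.col (p i) := by
        rw [hdecomp, add_sub_cancel_left]
      rw [this]
      exact Submodule.sub_mem _ (Submodule.subset_span ⟨c, hc, rfl⟩) h1
    have h4 := congrFun h3 r
    simp [hcolp, Finset.sum_apply, Pi.single_apply, hpr] at h4
    exact h h4
  constructor
  · intro h1
    by_contra h2
    exact main Tᶜ (by rw [compl_compl]; exact hdis.symm) h2 h1
  · exact main T hdis

theorem Equiv.Perm.SameCycle.exists_leaving {α : Type*} [Finite α] {f : Equiv.Perm α} {x y : α}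
    (h : f.SameCycle x y) {Q : α → Prop} (hx : Q x) (hy : ¬ Q y) :
    ∃ z, f.SameCycle x z ∧ Q z ∧ ¬ Q (f z) := by
  by_contra hcon
  push Not at hcon
  obtain ⟨k, rfl⟩ := h.exists_nat_pow_eq
  have : ∀ k : ℕ, Q ((f ^ k) x) := by
    intro k
    induction k with
    | zero => simpa using hx
    | succ k ih =>
      rw [pow_succ', Equiv.Perm.mul_apply]
      exact hcon _ ⟨k, by simp⟩ ih
  exact hy (this k)

/-- A level strictly inside the range of a cycle is crossed by an increasing and by a decreasing
step of the cycle. -/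
theorem Equiv.Perm.SameCycle.exists_step_across {m : ℕ} {κ : Fin m → ℝ} (hκ : StrictMono κ)
    {f : Equiv.Perm (Fin m)} {x y : Fin m} (h : f.SameCycle x y) {t : ℝ} (ht : ∀ i, κ i ≠ t)
    (hx : κ x < t) (hy : t < κ y) :
    (∃ z, f.SameCycle x z ∧ z < f z ∧ κ z < t ∧ t < κ (f z)) ∧
    (∃ z, f.SameCycle x z ∧ f z < z ∧ κ (f z) < t ∧ t < κ z) := by
  constructor
  · obtain ⟨z, hz, h1, h2⟩ := h.exists_leaving (Q := fun i => κ i < t) hx (not_lt.2 hy.le)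
    have h3 : t < κ (f z) := lt_of_le_of_ne (not_lt.1 h2) (ht _).symm
    exact ⟨z, hz, hκ.lt_iff_lt.1 (h1.trans h3), h1, h3⟩
  · obtain ⟨z, hz, h1, h2⟩ := h.symm.exists_leaving (Q := fun i => t < κ i) hy (not_lt.2 hx.le)
    have h3 : κ (f z) < t := lt_of_le_of_ne (not_lt.1 h2) (ht _)
    exact ⟨z, h.trans hz, hκ.lt_iff_lt.1 (h3.trans h1), h3, h1⟩

theorem ChordsCross.symm {a b c d : ℝ} (h : ChordsCross a b c d) : ChordsCross c d a b :=
  Or.symm h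

section NonCrossing

variable {m₁ m₂ : ℕ} {κ₁ : Fin m₁ → ℝ} {π₁ : Equiv.Perm (Fin m₁)} {κ₂ : Fin m₂ → ℝ}
  {π₂ : Equiv.Perm (Fin m₂)}

theorem NonCrossing.symm (h : NonCrossing κ₁ π₁ κ₂ π₂) : NonCrossing κ₂ π₂ κ₁ π₁ :=
  ⟨fun i j hi hj hc => h.1 j i hj hi hc.symm, fun i j hi hj hc => h.2 j i hj hi hc.symm⟩

/-- A cycle with a point strictly inside the range of a cycle of the other permutation lies
entirely inside that range. -/
theorem NonCrossing.cycle_subset_range (hκ₁ : StrictMono κ₁) (hκ₂ : StrictMono κ₂)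
    (hκ : ∀ i j, κ₁ i ≠ κ₂ j) (h : NonCrossing κ₁ π₁ κ₂ π₂) {x y : Fin m₁}
    (hxy : π₁.SameCycle x y) {d d' : Fin m₂} (hd : π₂.SameCycle d d') (hx1 : κ₂ d < κ₁ x)
    (hx2 : κ₁ x < κ₂ d') :
    ∃ e e', π₂.SameCycle d e ∧ π₂.SameCycle d e' ∧ κ₂ e < κ₁ y ∧ κ₁ y < κ₂ e' := by
  by_contra hy
  obtain ⟨z, hz, hz1, hz2⟩ := hxy.symm.exists_leaving
    (Q := fun y => ¬ ∃ e e', π₂.SameCycle d e ∧ π₂.SameCycle d e' ∧ κ₂ e < κ₁ y ∧ κ₁ y < κ₂ e')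
    hy (not_not.2 ⟨d, d', .refl _ _, hd, hx1, hx2⟩)
  obtain ⟨e, e', he, he', h1, h2⟩ := not_not.1 hz2
  have hstep := (he.symm.trans he').exists_step_across hκ₂ (fun i => (hκ _ i).symm) h1 h2
  rcases lt_or_gt_of_ne (hκ z e) with hlt | hgt
  · obtain ⟨w, hw, hw1, hw2, hw3⟩ := hstep.1
    have hzw : κ₁ z < κ₂ w := by
      by_contra hcon
      exact hz1 ⟨w, e, he.trans hw, he, lt_of_le_of_ne (not_lt.1 hcon) (hκ _ _).symm, hlt⟩
    exact h.1 z w (hκ₁.lt_iff_lt.1 (hlt.trans h1)) hw1 (Or.inl ⟨hzw, hw2, hw3⟩)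
  · have hze' : κ₂ e' < κ₁ z := by
      by_contra hcon
      exact hz1 ⟨e, e', he, he', hgt, lt_of_le_of_ne (not_lt.1 hcon) (hκ _ _)⟩
    obtain ⟨w, hw, hw1, hw2, hw3⟩ := hstep.2
    have hzw : κ₂ w < κ₁ z := by
      by_contra hcon
      exact hz1 ⟨e', w, he', he.trans hw, hze', lt_of_le_of_ne (not_lt.1 hcon) (hκ _ _)⟩
    exact h.2 z w (hκ₁.lt_iff_lt.1 (h2.trans hze')) hw1 (Or.inr ⟨hw2, hw3, hzw⟩)

/-- Cycles of non-crossing permutations do not interlace. -/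
theorem NonCrossing.not_interlaced (hκ₁ : StrictMono κ₁) (hκ₂ : StrictMono κ₂)
    (hκ : ∀ i j, κ₁ i ≠ κ₂ j) (h : NonCrossing κ₁ π₁ κ₂ π₂) {a a' : Fin m₁}
    (ha : π₁.SameCycle a a') {b b' : Fin m₂} (hb : π₂.SameCycle b b') (h1 : κ₁ a < κ₂ b)
    (h2 : κ₂ b < κ₁ a') (h3 : κ₁ a' < κ₂ b') : False := by
  classical
  obtain ⟨g, hg, hmin⟩ := Finset.exists_min_image
    (Finset.univ.filter fun g => π₁.SameCycle a g) κ₁ ⟨a, by simp [Equiv.Perm.SameCycle.refl]⟩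
  simp only [Finset.mem_filter, Finset.mem_univ, true_and] at hg hmin
  obtain ⟨e, e', he, -, h4, -⟩ :=
    h.cycle_subset_range hκ₁ hκ₂ hκ (ha.symm.trans hg) hb h2 h3
  obtain ⟨f, f', hf, -, h5, -⟩ :=
    h.symm.cycle_subset_range hκ₂ hκ₁ (fun i j => (hκ j i).symm) he ha h1 h2
  exact absurd (hmin f hf) (not_le.2 (h5.trans h4))

theorem NonCrossing.between_of_between (hκ₁ : StrictMono κ₁) (hκ₂ : StrictMono κ₂)
    (hκ : ∀ i j, κ₁ i ≠ κ₂ j) (h : NonCrossing κ₁ π₁ κ₂ π₂) {i i' : Fin m₁}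
    (hi : π₁.SameCycle i i') {j j' : Fin m₂} (hj : π₂.SameCycle j j') (h1 : κ₁ i < κ₂ j)
    (h2 : κ₂ j < κ₁ i') : κ₁ i < κ₂ j' ∧ κ₂ j' < κ₁ i' := by
  constructor
  · by_contra hcon
    have h3 : κ₂ j' < κ₁ i := lt_of_le_of_ne (not_lt.1 hcon) (hκ _ _).symm
    exact h.symm.not_interlaced hκ₂ hκ₁ (fun i j => (hκ j i).symm) hj.symm hi h3 h1 h2
  · by_contra hcon
    have h3 : κ₁ i' < κ₂ j' := lt_of_le_of_ne (not_lt.1 hcon) (hκ _ _)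
    exact h.not_interlaced hκ₁ hκ₂ hκ hi hj h1 h2 h3

end NonCrossing

/-- When the permutations of two matrices in reduced row echelon form are non-crossing, the pair
formed by the pivot and the column of a nonzero entry of the first does not cross any such pair
of the second. -/
theorem pivot_between_iff_col_between {n₁ m₁ n₂ m₂ : ℕ} {κ₁ : Fin m₁ → ℝ} {κ₂ : Fin m₂ → ℝ}
    (hκ₁ : StrictMono κ₁) (hκ₂ : StrictMono κ₂) (hκ : ∀ i j, κ₁ i ≠ κ₂ j)
    {A₁ : Matrix (Fin n₁) (Fin m₁) ℝ} {A₂ : Matrix (Fin n₂) (Fin m₂) ℝ}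
    (h : NonCrossing κ₁ (tnnPerm A₁) κ₂ (tnnPerm A₂))
    {p₁ : Fin n₁ → Fin m₁} (hp₁ : ∀ i i', A₁ i (p₁ i') = if i = i' then 1 else 0)
    {p₂ : Fin n₂ → Fin m₂} (hp₂ : ∀ i i', A₂ i (p₂ i') = if i = i' then 1 else 0)
    {x : Fin n₁} {c : Fin m₁} (hx : A₁ x c ≠ 0) {y : Fin n₂} {c' : Fin m₂} (hy : A₂ y c' ≠ 0) :
    (κ₂ (p₂ y) < κ₁ (p₁ x) ∧ κ₁ (p₁ x) < κ₂ c') ↔ (κ₂ (p₂ y) < κ₁ c ∧ κ₁ c < κ₂ c') := by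
  have step : ∀ i i' : Fin m₁, (tnnPerm A₁).SameCycle i i' →
      (κ₁ i < κ₂ (p₂ y) ∧ κ₂ (p₂ y) < κ₁ i' ↔ κ₁ i < κ₂ c' ∧ κ₂ c' < κ₁ i') := by
    intro i i' hi
    refine mem_iff_mem_of_tnnPerm_invariant hp₂ {j | κ₁ i < κ₂ j ∧ κ₂ j < κ₁ i'} ⟨?_⟩ ?_ hy
    · intro j hj k hk l hl
      exact ⟨hj.1.trans_le (hκ₂.monotone hl.1), (hκ₂.monotone hl.2).trans_lt hk.2⟩
    · intro j hj
      exact h.between_of_between hκ₁ hκ₂ hκ hi (by simp [Equiv.Perm.SameCycle.refl]) hj.1 hj.2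
  refine mem_iff_mem_of_tnnPerm_invariant hp₁ {a | κ₂ (p₂ y) < κ₁ a ∧ κ₁ a < κ₂ c'} ⟨?_⟩ ?_ hx
  · intro j hj k hk l hl
    exact ⟨hj.1.trans_le (hκ₁.monotone hl.1), (hκ₁.monotone hl.2).trans_lt hk.2⟩
  · rintro i ⟨h1, h2⟩
    have hs := step i (tnnPerm A₁ i) (by simp [Equiv.Perm.SameCycle.refl])
    have hs' := step (tnnPerm A₁ i) i (by simp [Equiv.Perm.SameCycle.refl])
    have k1 := hκ (tnnPerm A₁ i) (p₂ y)
    have k2 := hκ (tnnPerm A₁ i) c'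
    constructor
    · by_contra hcon
      have h3 : κ₁ (tnnPerm A₁ i) < κ₂ (p₂ y) := lt_of_le_of_ne (not_lt.1 hcon) k1
      exact absurd (hs'.1 ⟨h3, h1⟩).2 (not_lt.2 h2.le)
    · by_contra hcon
      have h3 : κ₂ c' < κ₁ (tnnPerm A₁ i) := lt_of_le_of_ne (not_lt.1 hcon) k2.symm
      exact absurd (hs.2 ⟨h2, h3⟩).1 (not_lt.2 h1.le)

/-- The sign of `b - a`. -/
noncomputable def ltSign (a b : ℝ) : ℝ := if a < b then 1 else if b < a then -1 else 0

theorem ltSign_of_lt {a b : ℝ} (h : a < b) : ltSign a b = 1 := if_pos h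

theorem ltSign_of_gt {a b : ℝ} (h : b < a) : ltSign a b = -1 := by
  rw [ltSign, if_neg (not_lt.2 h.le), if_pos h]

theorem ltSign_swap (a b : ℝ) : ltSign a b = -ltSign b a := by
  rcases lt_trichotomy a b with h | rfl | h
  · rw [ltSign_of_lt h, ltSign_of_gt h, neg_neg]
  · simp [ltSign]
  · rw [ltSign_of_lt h, ltSign_of_gt h]

theorem ltSign_mul_self {a b : ℝ} (h : a ≠ b) : ltSign a b * ltSign a b = 1 := by
  rcases lt_or_gt_of_ne h with h | h
  · rw [ltSign_of_lt h, one_mul]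
  · rw [ltSign_of_gt h, neg_mul_neg, one_mul]

/-- The sign of the permutation that sorts the sequence `g`. -/
noncomputable def ordSign {n : ℕ} (g : Fin n → ℝ) : ℝ :=
  ∏ j, ∏ i, if i < j then ltSign (g i) (g j) else 1

theorem sign_eq_ordSign {n : ℕ} {g : Fin n → ℝ} {σ : Equiv.Perm (Fin n)}
    (h : StrictMono (g ∘ σ)) : ((σ.sign : ℤ) : ℝ) = ordSign g := by
  have key := σ.prod_Iio_comp_eq_sign_mul_prod (f := fun i j => ltSign (g i) (g j))
    (fun i j => ltSign_swap _ _)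
  have h1 : ∏ j, ∏ i ∈ Finset.Iio j, ltSign (g (σ i)) (g (σ j)) = 1 :=
    Finset.prod_eq_one fun j _ => Finset.prod_eq_one fun i hi =>
      ltSign_of_lt (h (Finset.mem_Iio.1 hi))
  have h2 : ∏ j, ∏ i ∈ Finset.Iio j, ltSign (g i) (g j) = ordSign g := by
    refine Finset.prod_congr rfl fun j _ => ?_
    rw [← Finset.prod_filter]
    congr 1
    ext i
    simp
  rw [h1, h2] at key
  rcases Int.units_eq_one_or σ.sign with hs | hs <;> rw [hs] at key ⊢ <;> push_cast at key ⊢ <;>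
    linarith

theorem ordSign_append {a b : ℕ} (f : Fin a → ℝ) (g : Fin b → ℝ) :
    ordSign (Fin.append f g) = ordSign f * ordSign g * ∏ x, ∏ y, ltSign (f x) (g y) := by
  have h1 : ∀ (x : Fin a) (y : Fin b), Fin.castAdd b x < Fin.natAdd a y := fun x y => by
    rw [Fin.lt_def, Fin.val_castAdd, Fin.val_natAdd]; omega
  have h2 : ∀ (x : Fin a) (y : Fin b), ¬ Fin.natAdd a y < Fin.castAdd b x := fun x y =>
    (h1 x y).not_gt
  have h3 : ∀ x y : Fin a, Fin.castAdd b x < Fin.castAdd b y ↔ x < y := fun x y => Iff.rfl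
  have h4 : ∀ x y : Fin b, Fin.natAdd a x < Fin.natAdd a y ↔ x < y := fun x y => by
    rw [Fin.lt_def, Fin.val_natAdd, Fin.val_natAdd, Fin.lt_def]; omega
  simp only [ordSign, Fin.prod_univ_add, Fin.append_left, Fin.append_right, h1, h2, h3, h4,
    if_true, if_false, Finset.prod_const_one, Finset.prod_mul_distrib]
  rw [Finset.prod_comm (f := fun y x => ltSign (f x) (g y))]
  ring

theorem exists_perm_of_det_ne_zero {n : Type*} [DecidableEq n] [Fintype n] {R : Type*}
    [CommRing R] {M : Matrix n n R} (h : M.det ≠ 0) :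
    ∃ σ : Equiv.Perm n, ∀ i, M (σ i) i ≠ 0 := by
  by_contra hcon
  push Not at hcon
  refine h ?_
  rw [Matrix.det_apply']
  refine Finset.sum_eq_zero fun σ _ => ?_
  obtain ⟨i, hi⟩ := hcon σ
  have h0 : ∏ j, M (σ j) j = 0 := Finset.prod_eq_zero (Finset.mem_univ i) hi
  rw [h0, mul_zero]

/-- A minor with arbitrary distinct columns is a maximal minor up to the sign of the sorting
permutation. -/
theorem exists_det_submatrix_eq_ordSign_mul {n m : ℕ} {κ : Fin m → ℝ} (hκ : StrictMono κ)
    {c : Fin n → Fin m} (hc : Function.Injective c) :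
    ∃ I : Fin n ↪o Fin m, ∀ A : Matrix (Fin n) (Fin m) ℝ,
      maximalMinor A I = ordSign (κ ∘ c) * (A.submatrix id c).det := by
  have hmono : StrictMono (c ∘ Tuple.sort c) :=
    (Tuple.monotone_sort c).strictMono_of_injective (hc.comp (Tuple.sort c).injective)
  refine ⟨OrderEmbedding.ofStrictMono _ hmono, fun A => ?_⟩
  have h := sign_eq_ordSign (g := κ ∘ c) (σ := Tuple.sort c) (hκ.comp hmono)
  rw [← h, ← Matrix.det_permute']
  rfl

theorem ordSign_mul_self {n m : ℕ} {κ : Fin m → ℝ} (hκ : StrictMono κ)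
    {c : Fin n → Fin m} (hc : Function.Injective c) : ordSign (κ ∘ c) * ordSign (κ ∘ c) = 1 := by
  have hmono : StrictMono (c ∘ Tuple.sort c) :=
    (Tuple.monotone_sort c).strictMono_of_injective (hc.comp (Tuple.sort c).injective)
  have h := sign_eq_ordSign (g := κ ∘ c) (σ := Tuple.sort c) (hκ.comp hmono)
  rw [← h]
  rcases Int.units_eq_one_or (Tuple.sort c).sign with hs | hs <;> rw [hs] <;> norm_num

theorem pivot_le_of_maximalMinor_ne_zero {n m : ℕ} {A : Matrix (Fin n) (Fin m) ℝ}
    {p : Fin n → Fin m} (hp : StrictMono p) (h0 : ∀ i j, j < p i → A i j = 0)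
    {I : Fin n ↪o Fin m} (hI : maximalMinor A I ≠ 0) (r : Fin n) : p r ≤ I r := by
  obtain ⟨σ, hσ⟩ := exists_perm_of_det_ne_zero hI
  by_contra hlt
  rw [not_le] at hlt
  have hmaps : ∀ i ∈ Finset.Iic r, σ i ∈ Finset.Iio r := by
    intro i hi
    have h1 : p (σ i) ≤ I i := by
      by_contra hcon
      exact hσ i (h0 _ _ (not_le.1 hcon))
    rw [Finset.mem_Iio, ← hp.lt_iff_lt]
    exact h1.trans_lt ((I.monotone (Finset.mem_Iic.1 hi)).trans_lt hlt)
  have := Finset.card_le_card_of_injOn σ hmaps (σ.injective.injOn)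
  simp at this

theorem maximalMinor_pivots {n m : ℕ} {A : Matrix (Fin n) (Fin m) ℝ}
    {p : Fin n → Fin m} (hp : StrictMono p) (h1 : ∀ i i', A i (p i') = if i = i' then 1 else 0) :
    maximalMinor A (OrderEmbedding.ofStrictMono p hp) = 1 := by
  have : A.submatrix id (OrderEmbedding.ofStrictMono p hp) = 1 := by
    ext i j
    simp [h1, Matrix.one_apply]
  rw [maximalMinor, this, Matrix.det_one]

theorem det_submatrix_update_pivot {n m : ℕ} {A : Matrix (Fin n) (Fin m) ℝ}
    {p : Fin n → Fin m} (h1 : ∀ i i', A i (p i') = if i = i' then 1 else 0) (i : Fin n)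
    (c : Fin m) : (A.submatrix id (Function.update p i c)).det = A i c := by
  have : A.submatrix id (Function.update p i c)
      = (1 : Matrix (Fin n) (Fin n) ℝ).updateCol i (A.col c) := by
    ext a b
    by_cases hb : b = i
    · subst hb
      simp
    · simp [hb, h1, Matrix.one_apply]
  rw [this, ← Matrix.cramer_apply, Matrix.cramer_one]
  rfl

/-- A matrix in reduced row echelon form is determined by its maximal minors. -/
theorem IsRREF.eq_of_maximalMinor_eq {n m : ℕ} {A B : Matrix (Fin n) (Fin m) ℝ} (hA : IsRREF A)
    (hB : IsRREF B) (h : ∀ I, maximalMinor A I = maximalMinor B I) : A = B := by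
  obtain ⟨p, hp, hp0, hp1⟩ := hA
  obtain ⟨q, hq, hq0, hq1⟩ := hB
  have hpq : p = q := by
    funext r
    apply le_antisymm
    · exact pivot_le_of_maximalMinor_ne_zero hp hp0 (I := OrderEmbedding.ofStrictMono q hq)
        (by rw [h, maximalMinor_pivots hq hq1]; exact one_ne_zero) r
    · exact pivot_le_of_maximalMinor_ne_zero hq hq0 (I := OrderEmbedding.ofStrictMono p hp)
        (by rw [← h, maximalMinor_pivots hp hp1]; exact one_ne_zero) r
  subst hpq
  ext i c
  by_cases hc : ∃ k, p k = c
  · obtain ⟨k, rfl⟩ := hc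
    rw [hp1, hq1]
  · have hinj : Function.Injective (Function.update p i c) := by
      intro a b hab
      by_cases ha : a = i <;> by_cases hb : b = i
      · rw [ha, hb]
      · rw [ha, Function.update_self, Function.update_of_ne hb] at hab
        exact absurd ⟨b, hab.symm⟩ hc
      · rw [hb, Function.update_self, Function.update_of_ne ha] at hab
        exact absurd ⟨a, hab⟩ hc
      · rw [Function.update_of_ne ha, Function.update_of_ne hb] at hab
        exact hp.injective hab
    have hκ : StrictMono (fun k : Fin m => (k.val : ℝ)) := fun a b hab =>
      Nat.cast_lt.2 (Fin.lt_def.1 hab)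
    obtain ⟨I, hI⟩ := exists_det_submatrix_eq_ordSign_mul hκ hinj
    have h2 := ordSign_mul_self hκ hinj
    have h3 := h I
    rw [hI A, hI B, det_submatrix_update_pivot hp1, det_submatrix_update_pivot hq1] at h3
    have h4 := congrArg
      (fun t => ordSign ((fun k : Fin m => (k.val : ℝ)) ∘ Function.update p i c) * t) h3
    simpa only [← mul_assoc, h2, one_mul] using h4

theorem rescaled_minor {n m : ℕ} {A B : Matrix (Fin n) (Fin m) ℝ} {δ : Fin n → ℝ} {ε : Fin m → ℝ}
    (h : ∀ i c, B i c = δ i * ε c * A i c) (c : Fin n → Fin m) :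
    (B.submatrix id c).det = (∏ i, δ i) * (∏ i, ε (c i)) * (A.submatrix id c).det := by
  rw [mul_assoc, ← Matrix.det_mul_row, ← Matrix.det_mul_column]
  congr 1
  ext i j
  simp [h, mul_assoc]

/-- If a matrix, up to nonzero scalings of rows and columns, sits as a diagonal block in a larger
matrix, its columns being in increasing order, then its permutation is induced by that of the
larger matrix. -/
theorem tnnPerm_of_block {n m N M : ℕ} {A : Matrix (Fin n) (Fin m) ℝ} {K : Matrix (Fin N) (Fin M) ℝ}
    {r : Fin n → Fin N} (hr : Function.Injective r) {e : Fin m → Fin M} (he : StrictMono e)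
    {δ : Fin n → ℝ} (hδ : ∀ x, δ x ≠ 0) {ε : Fin m → ℝ} (hε : ∀ c, ε c ≠ 0)
    (hblock : ∀ x c, K (r x) (e c) = δ x * ε c * A x c)
    (hbelow : ∀ u c, u ∉ Set.range r → K u (e c) = 0)
    (hright : ∀ x u, u ∉ Set.range e → K (r x) u = 0) (i : Fin m) :
    tnnPerm K (e i) = e (tnnPerm A i) := by
  let ι : (Fin n → ℝ) →ₗ[ℝ] (Fin N → ℝ) :=
    Function.ExtendByZero.linearMap ℝ r ∘ₗ LinearMap.pi fun x => δ x • LinearMap.proj x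
  let π : (Fin N → ℝ) →ₗ[ℝ] (Fin n → ℝ) := LinearMap.pi fun x => (δ x)⁻¹ • LinearMap.proj (r x)
  have hι : ∀ c, K.col (e c) = ε c • ι (A.col c) := by
    intro c
    ext u
    by_cases hu : u ∈ Set.range r
    · obtain ⟨x, rfl⟩ := hu
      simp [ι, hr.extend_apply, hblock]
      ring
    · have : ¬ ∃ x, r x = u := hu
      simp [ι, Function.extend_apply' _ _ _ this, hbelow u c hu]
  have hπ : ∀ c, π (K.col (e c)) = ε c • A.col c := by
    intro c
    ext x
    have := hδ x
    simp only [π, LinearMap.pi_apply, LinearMap.smul_apply, LinearMap.proj_apply, Matrix.col_apply,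
      hblock, smul_eq_mul, Pi.smul_apply]
    field_simp
  have hπ0 : ∀ u, u ∉ Set.range e → π (K.col u) = 0 := by
    intro u hu
    ext x
    simp [π, hright x u hu]
  have up : ∀ S : Set (Fin m), A.col i ∈ Submodule.span ℝ (A.col '' S) →
      K.col (e i) ∈ Submodule.span ℝ (K.col '' (e '' S)) := by
    intro S hS
    rw [hι]
    refine Submodule.smul_mem _ _ ?_
    have := Submodule.mem_map_of_mem (f := ι) hS
    rw [Submodule.map_span] at this
    refine Submodule.span_le.2 ?_ this
    rintro _ ⟨_, ⟨c, hc, rfl⟩, rfl⟩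
    have h1 : ι (A.col c) = (ε c)⁻¹ • K.col (e c) := by
      rw [hι, smul_smul, inv_mul_cancel₀ (hε c), one_smul]
    rw [h1]
    exact Submodule.smul_mem _ _ (Submodule.subset_span ⟨e c, ⟨c, hc, rfl⟩, rfl⟩)
  have down : ∀ U : Set (Fin M), K.col (e i) ∈ Submodule.span ℝ (K.col '' U) →
      A.col i ∈ Submodule.span ℝ (A.col '' (e ⁻¹' U)) := by
    intro U hU
    have h1 := Submodule.mem_map_of_mem (f := π) hU
    rw [Submodule.map_span, hπ] at h1
    have h2 : A.col i = (ε i)⁻¹ • ε i • A.col i := by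
      rw [smul_smul, inv_mul_cancel₀ (hε i), one_smul]
    rw [h2]
    refine Submodule.smul_mem _ _ (Submodule.span_le.2 ?_ h1)
    rintro _ ⟨_, ⟨u, hu, rfl⟩, rfl⟩
    by_cases hue : u ∈ Set.range e
    · obtain ⟨c, rfl⟩ := hue
      rw [hπ]
      exact Submodule.smul_mem _ _ (Submodule.subset_span ⟨c, hu, rfl⟩)
    · rw [hπ0 u hue]
      exact Submodule.zero_mem _
  have harc : ∀ j c, e c ∈ backArc (e j) (e i) ↔ c ∈ backArc j i := by
    intro j c
    simp only [backArc, Set.mem_ofPred_eq, he.lt_iff_lt, he.le_iff_le]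
  by_cases h0 : A.col i = 0
  · rw [tnnPerm_of_col_eq_zero h0, tnnPerm_of_col_eq_zero (by rw [hι, h0, map_zero, smul_zero])]
  · refine tnnPerm_eq_of_mem_span ?_ fun hmem => ?_
    · refine Submodule.span_mono (Set.image_mono ?_) (up _ (col_mem_span_backArc_tnnPerm A i))
      rintro _ ⟨c, hc, rfl⟩
      exact (harc _ _).2 hc
    · refine col_notMem_span_backArc_diff_tnnPerm h0
        (Submodule.span_mono (Set.image_mono ?_) (down _ hmem))
      rintro c ⟨hc1, hc2⟩
      refine ⟨(harc _ _).1 hc1, fun hc => hc2 ?_⟩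
      rw [Set.mem_singleton_iff] at hc ⊢
      rw [hc]

section KappaPos

variable {m₁ m₂ : ℕ} (κ₁ : Fin m₁ → ℝ) (κ₂ : Fin m₂ → ℝ)

/-- The increasing list of all parameters. -/
noncomputable def kappaSorted : Fin (m₁ + m₂) → ℝ := Fin.append κ₁ κ₂ ∘ kappaSort κ₁ κ₂

theorem kappaSort_kappaPosLeft (c : Fin m₁) :
    kappaSort κ₁ κ₂ (kappaPosLeft κ₁ κ₂ c) = Fin.castAdd m₂ c :=
  (kappaSort κ₁ κ₂).apply_symm_apply _

theorem kappaSort_kappaPosRight (c : Fin m₂) :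
    kappaSort κ₁ κ₂ (kappaPosRight κ₁ κ₂ c) = Fin.natAdd m₁ c :=
  (kappaSort κ₁ κ₂).apply_symm_apply _

theorem kappaSorted_kappaPosLeft (c : Fin m₁) :
    kappaSorted κ₁ κ₂ (kappaPosLeft κ₁ κ₂ c) = κ₁ c := by
  rw [kappaSorted, Function.comp_apply, kappaSort_kappaPosLeft, Fin.append_left]

theorem kappaSorted_kappaPosRight (c : Fin m₂) :
    kappaSorted κ₁ κ₂ (kappaPosRight κ₁ κ₂ c) = κ₂ c := by
  rw [kappaSorted, Function.comp_apply, kappaSort_kappaPosRight, Fin.append_right]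

theorem eq_kappaPosLeft_or_eq_kappaPosRight (u : Fin (m₁ + m₂)) :
    (∃ c, u = kappaPosLeft κ₁ κ₂ c) ∨ ∃ c, u = kappaPosRight κ₁ κ₂ c := by
  have key : ∀ v, kappaSort κ₁ κ₂ u = v → u = (kappaSort κ₁ κ₂).symm v := fun v h => by
    rw [← h, Equiv.symm_apply_apply]
  generalize hv : kappaSort κ₁ κ₂ u = v at key
  induction v using Fin.addCases with
  | left c => exact Or.inl ⟨c, key _ rfl⟩
  | right c => exact Or.inr ⟨c, key _ rfl⟩

theorem kappaPosLeft_ne_kappaPosRight (c : Fin m₁) (c' : Fin m₂) :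
    kappaPosLeft κ₁ κ₂ c ≠ kappaPosRight κ₁ κ₂ c' := by
  intro h
  have h1 := congrArg (kappaSort κ₁ κ₂) h
  rw [kappaSort_kappaPosLeft, kappaSort_kappaPosRight, Fin.ext_iff, Fin.val_castAdd,
    Fin.val_natAdd] at h1
  omega

variable {κ₁ κ₂}

theorem kappaSorted_strictMono (hκ₁ : StrictMono κ₁) (hκ₂ : StrictMono κ₂)
    (hκ : ∀ i j, κ₁ i ≠ κ₂ j) : StrictMono (kappaSorted κ₁ κ₂) := by
  refine (Tuple.monotone_sort _).strictMono_of_injective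
    (Function.Injective.comp ?_ (kappaSort κ₁ κ₂).injective)
  exact Fin.append_injective_iff.2 ⟨hκ₁.injective, hκ₂.injective, hκ⟩

theorem kappaPosLeft_strictMono (hκ₁ : StrictMono κ₁) (hκ₂ : StrictMono κ₂)
    (hκ : ∀ i j, κ₁ i ≠ κ₂ j) : StrictMono (kappaPosLeft κ₁ κ₂) := by
  intro a b hab
  rw [← (kappaSorted_strictMono hκ₁ hκ₂ hκ).lt_iff_lt, kappaSorted_kappaPosLeft,
    kappaSorted_kappaPosLeft]
  exact hκ₁ hab

theorem kappaPosRight_strictMono (hκ₁ : StrictMono κ₁) (hκ₂ : StrictMono κ₂)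
    (hκ : ∀ i j, κ₁ i ≠ κ₂ j) : StrictMono (kappaPosRight κ₁ κ₂) := by
  intro a b hab
  rw [← (kappaSorted_strictMono hκ₁ hκ₂ hκ).lt_iff_lt, kappaSorted_kappaPosRight,
    kappaSorted_kappaPosRight]
  exact hκ₂ hab

theorem kappaPermProd_kappaPosLeft (π₁ : Equiv.Perm (Fin m₁)) (π₂ : Equiv.Perm (Fin m₂))
    (c : Fin m₁) : kappaPermProd κ₁ κ₂ π₁ π₂ (kappaPosLeft κ₁ κ₂ c)
      = kappaPosLeft κ₁ κ₂ (π₁ c) := by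
  rw [kappaPermProd, Equiv.Perm.mul_apply,
    Equiv.Perm.viaFintypeEmbedding_apply_notMem_range (e := π₂),
    Equiv.Perm.viaFintypeEmbedding_apply_image]
  rintro ⟨c', h⟩
  exact kappaPosLeft_ne_kappaPosRight κ₁ κ₂ c c' h.symm

theorem kappaPermProd_kappaPosRight (π₁ : Equiv.Perm (Fin m₁)) (π₂ : Equiv.Perm (Fin m₂))
    (c : Fin m₂) : kappaPermProd κ₁ κ₂ π₁ π₂ (kappaPosRight κ₁ κ₂ c)
      = kappaPosRight κ₁ κ₂ (π₂ c) := by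
  rw [kappaPermProd, Equiv.Perm.mul_apply, Equiv.Perm.viaFintypeEmbedding_apply_image,
    Equiv.Perm.viaFintypeEmbedding_apply_notMem_range]
  rintro ⟨c', h⟩
  exact kappaPosLeft_ne_kappaPosRight κ₁ κ₂ c' _ h

end KappaPos

section KappaBlock

variable {n₁ m₁ n₂ m₂ : ℕ} {κ₁ : Fin m₁ → ℝ} {κ₂ : Fin m₂ → ℝ}
  (A₁ : Matrix (Fin n₁) (Fin m₁) ℝ) (A₂ : Matrix (Fin n₂) (Fin m₂) ℝ)

theorem kappaBlock_left_left (x : Fin n₁) (c : Fin m₁) :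
    kappaBlock κ₁ κ₂ A₁ A₂ (Fin.castAdd n₂ x) (kappaPosLeft κ₁ κ₂ c) = A₁ x c := by
  simp [kappaBlock, kappaSort_kappaPosLeft]

theorem kappaBlock_left_right (x : Fin n₁) (c : Fin m₂) :
    kappaBlock κ₁ κ₂ A₁ A₂ (Fin.castAdd n₂ x) (kappaPosRight κ₁ κ₂ c) = 0 := by
  simp [kappaBlock, kappaSort_kappaPosRight]

theorem kappaBlock_right_left (y : Fin n₂) (c : Fin m₁) :
    kappaBlock κ₁ κ₂ A₁ A₂ (Fin.natAdd n₁ y) (kappaPosLeft κ₁ κ₂ c) = 0 := by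
  simp [kappaBlock, kappaSort_kappaPosLeft]

theorem kappaBlock_right_right (y : Fin n₂) (c : Fin m₂) :
    kappaBlock κ₁ κ₂ A₁ A₂ (Fin.natAdd n₁ y) (kappaPosRight κ₁ κ₂ c) = A₂ y c := by
  simp [kappaBlock, kappaSort_kappaPosRight]

/-- The column positions of two sequences of columns of the summands. -/
noncomputable def kappaPos {a b : ℕ} (κ₁ : Fin m₁ → ℝ) (κ₂ : Fin m₂ → ℝ) (c₁ : Fin a → Fin m₁)
    (c₂ : Fin b → Fin m₂) : Fin (a + b) → Fin (m₁ + m₂) :=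
  Fin.append (kappaPosLeft κ₁ κ₂ ∘ c₁) (kappaPosRight κ₁ κ₂ ∘ c₂)

theorem kappaPos_injective {a b : ℕ} {c₁ : Fin a → Fin m₁} {c₂ : Fin b → Fin m₂}
    (h₁ : Function.Injective c₁) (h₂ : Function.Injective c₂) :
    Function.Injective (kappaPos κ₁ κ₂ c₁ c₂) :=
  Fin.append_injective_iff.2 ⟨(kappaPosLeft κ₁ κ₂).injective.comp h₁,
    (kappaPosRight κ₁ κ₂).injective.comp h₂, fun _ _ => kappaPosLeft_ne_kappaPosRight _ _ _ _⟩

theorem kappaSorted_comp_kappaPos {a b : ℕ} (c₁ : Fin a → Fin m₁) (c₂ : Fin b → Fin m₂) :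
    kappaSorted κ₁ κ₂ ∘ kappaPos κ₁ κ₂ c₁ c₂ = Fin.append (κ₁ ∘ c₁) (κ₂ ∘ c₂) := by
  funext u
  induction u using Fin.addCases with
  | left x => simp [kappaPos, kappaSorted_kappaPosLeft]
  | right y => simp [kappaPos, kappaSorted_kappaPosRight]

theorem det_kappaBlock_submatrix (c₁ : Fin n₁ → Fin m₁) (c₂ : Fin n₂ → Fin m₂) :
    ((kappaBlock κ₁ κ₂ A₁ A₂).submatrix id (kappaPos κ₁ κ₂ c₁ c₂)).det
      = (A₁.submatrix id c₁).det * (A₂.submatrix id c₂).det := by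
  rw [← Matrix.det_fromBlocks_zero₂₁ _ 0, ← Matrix.det_submatrix_equiv_self finSumFinEquiv]
  congr 1
  ext u v
  rcases u with x | y <;> rcases v with x' | y' <;>
    simp [kappaPos, kappaBlock_left_left, kappaBlock_left_right, kappaBlock_right_left,
      kappaBlock_right_right]

theorem leadingZeros_eq {n m : ℕ} {X : Matrix (Fin n) (Fin m) ℝ} {i : Fin n} {q : Fin m}
    (h0 : ∀ c < q, X i c = 0) (h1 : X i q ≠ 0) : leadingZeros X i = q.val := by
  classical
  have : (Finset.univ.filter fun c : Fin m => ∀ c' ≤ c, X i c' = 0) = Finset.Iio q := by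
    ext c
    simp only [Finset.mem_filter, Finset.mem_univ, true_and, Finset.mem_Iio]
    constructor
    · intro h
      by_contra hc
      exact h1 (h q (not_lt.1 hc))
    · intro h c' hc'
      exact h0 c' (hc'.trans_lt h)
  rw [leadingZeros]
  convert Fin.card_Iio q

variable {A₁ A₂} {p₁ : Fin n₁ → Fin m₁} {p₂ : Fin n₂ → Fin m₂}

theorem kappaBlock_kappaPos (hp₁ : ∀ i i', A₁ i (p₁ i') = if i = i' then 1 else 0)
    (hp₂ : ∀ i i', A₂ i (p₂ i') = if i = i' then 1 else 0) (u v : Fin (n₁ + n₂)) :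
    kappaBlock κ₁ κ₂ A₁ A₂ u (kappaPos κ₁ κ₂ p₁ p₂ v) = if u = v then 1 else 0 := by
  have h1 : ∀ (x : Fin n₁) (y : Fin n₂), Fin.castAdd n₂ x ≠ Fin.natAdd n₁ y := fun x y h => by
    rw [Fin.ext_iff, Fin.val_castAdd, Fin.val_natAdd] at h; omega
  induction u using Fin.addCases <;> induction v using Fin.addCases <;>
    simp [kappaPos, kappaBlock_left_left, kappaBlock_left_right, kappaBlock_right_left,
      kappaBlock_right_right, hp₁, hp₂, h1, (h1 _ _).symm]

theorem kappaBlock_eq_zero_of_lt (hκ₁ : StrictMono κ₁) (hκ₂ : StrictMono κ₂)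
    (hκ : ∀ i j, κ₁ i ≠ κ₂ j) (h₁ : ∀ i j, j < p₁ i → A₁ i j = 0)
    (h₂ : ∀ i j, j < p₂ i → A₂ i j = 0) (u : Fin (n₁ + n₂)) (c : Fin (m₁ + m₂))
    (hc : c < kappaPos κ₁ κ₂ p₁ p₂ u) : kappaBlock κ₁ κ₂ A₁ A₂ u c = 0 := by
  have hL := kappaPosLeft_strictMono hκ₁ hκ₂ hκ
  have hR := kappaPosRight_strictMono hκ₁ hκ₂ hκ
  induction u using Fin.addCases with
  | left x =>
    rcases eq_kappaPosLeft_or_eq_kappaPosRight κ₁ κ₂ c with ⟨c, rfl⟩ | ⟨c, rfl⟩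
    · rw [kappaBlock_left_left]
      rw [kappaPos, Fin.append_left] at hc
      exact h₁ _ _ (hL.lt_iff_lt.1 hc)
    · exact kappaBlock_left_right ..
  | right y =>
    rcases eq_kappaPosLeft_or_eq_kappaPosRight κ₁ κ₂ c with ⟨c, rfl⟩ | ⟨c, rfl⟩
    · exact kappaBlock_right_left ..
    · rw [kappaBlock_right_right]
      rw [kappaPos, Fin.append_right] at hc
      exact h₂ _ _ (hR.lt_iff_lt.1 hc)

/-- The permutation of the rows in the `κ`-direct sum: it sorts the pivots. -/
noncomputable def pivotSort (κ₁ : Fin m₁ → ℝ) (κ₂ : Fin m₂ → ℝ) (p₁ : Fin n₁ → Fin m₁)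
    (p₂ : Fin n₂ → Fin m₂) : Equiv.Perm (Fin (n₁ + n₂)) :=
  Tuple.sort fun u => (kappaPos κ₁ κ₂ p₁ p₂ u).val

theorem kappaPos_pivotSort_strictMono (hp₁ : StrictMono p₁) (hp₂ : StrictMono p₂) :
    StrictMono (kappaPos κ₁ κ₂ p₁ p₂ ∘ pivotSort κ₁ κ₂ p₁ p₂) := by
  have h := (Tuple.monotone_sort fun u => (kappaPos κ₁ κ₂ p₁ p₂ u).val).strictMono_of_injective
    ((Fin.val_injective.comp (kappaPos_injective hp₁.injective hp₂.injective)).comp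
      (Tuple.sort _).injective)
  exact fun a b hab => Fin.lt_def.2 (h hab)

theorem kappaDirectSum_eq (hκ₁ : StrictMono κ₁) (hκ₂ : StrictMono κ₂)
    (hκ : ∀ i j, κ₁ i ≠ κ₂ j) (h₁ : ∀ i j, j < p₁ i → A₁ i j = 0)
    (h₂ : ∀ i j, j < p₂ i → A₂ i j = 0)
    (hp₁ : ∀ i i', A₁ i (p₁ i') = if i = i' then 1 else 0)
    (hp₂ : ∀ i i', A₂ i (p₂ i') = if i = i' then 1 else 0) :
    kappaDirectSum κ₁ κ₂ A₁ A₂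
      = (kappaBlock κ₁ κ₂ A₁ A₂).submatrix (pivotSort κ₁ κ₂ p₁ p₂) id := by
  have : leadingZeros (kappaBlock κ₁ κ₂ A₁ A₂) = fun u => (kappaPos κ₁ κ₂ p₁ p₂ u).val := by
    funext u
    refine leadingZeros_eq (kappaBlock_eq_zero_of_lt hκ₁ hκ₂ hκ h₁ h₂ u) ?_
    rw [kappaBlock_kappaPos hp₁ hp₂, if_pos rfl]
    exact one_ne_zero
  rw [kappaDirectSum, this, pivotSort]

theorem isRREF_kappaDirectSum (hκ₁ : StrictMono κ₁) (hκ₂ : StrictMono κ₂)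
    (hκ : ∀ i j, κ₁ i ≠ κ₂ j) (h₁ : IsRREF A₁) (h₂ : IsRREF A₂) :
    IsRREF (kappaDirectSum κ₁ κ₂ A₁ A₂) := by
  obtain ⟨p₁, hm₁, hz₁, hp₁⟩ := h₁
  obtain ⟨p₂, hm₂, hz₂, hp₂⟩ := h₂
  rw [kappaDirectSum_eq hκ₁ hκ₂ hκ hz₁ hz₂ hp₁ hp₂]
  refine ⟨_, kappaPos_pivotSort_strictMono (κ₁ := κ₁) (κ₂ := κ₂) hm₁ hm₂, ?_, ?_⟩
  · intro i j hj
    exact kappaBlock_eq_zero_of_lt hκ₁ hκ₂ hκ hz₁ hz₂ _ _ hj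
  · intro i i'
    simp [kappaBlock_kappaPos hp₁ hp₂]

/-- A nonzero maximal minor of the `κ`-direct sum has a nonzero term in each of the blocks. -/
theorem exists_columns_of_maximalMinor_ne_zero {ρ : Equiv.Perm (Fin (n₁ + n₂))}
    {I : Fin (n₁ + n₂) ↪o Fin (m₁ + m₂)}
    (hI : maximalMinor ((kappaBlock κ₁ κ₂ A₁ A₂).submatrix ρ id) I ≠ 0) :
    ∃ (c₁ : Fin n₁ → Fin m₁) (c₂ : Fin n₂ → Fin m₂) (θ : Equiv.Perm (Fin (n₁ + n₂))),
      (∀ x, A₁ x (c₁ x) ≠ 0) ∧ (∀ y, A₂ y (c₂ y) ≠ 0) ∧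
      Function.Injective c₁ ∧ Function.Injective c₂ ∧ I ∘ θ = kappaPos κ₁ κ₂ c₁ c₂ := by
  obtain ⟨σ, hσ⟩ := exists_perm_of_det_ne_zero hI
  set θ := (σ.trans ρ).symm with hθ
  have hne : ∀ u, kappaBlock κ₁ κ₂ A₁ A₂ u (I (θ u)) ≠ 0 := by
    intro u
    have h1 : ρ (σ (θ u)) = u := (σ.trans ρ).apply_symm_apply u
    have h2 := hσ (θ u)
    simp only [Matrix.submatrix_apply, id_eq, h1] at h2
    exact h2
  have hleft : ∀ x, ∃ c, I (θ (Fin.castAdd n₂ x)) = kappaPosLeft κ₁ κ₂ c ∧ A₁ x c ≠ 0 := by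
    intro x
    have h := hne (Fin.castAdd n₂ x)
    rcases eq_kappaPosLeft_or_eq_kappaPosRight κ₁ κ₂ (I (θ (Fin.castAdd n₂ x)))
      with ⟨c, hc⟩ | ⟨c, hc⟩
    · rw [hc, kappaBlock_left_left] at h
      exact ⟨c, hc, h⟩
    · rw [hc, kappaBlock_left_right] at h
      exact absurd rfl h
  have hright : ∀ y, ∃ c, I (θ (Fin.natAdd n₁ y)) = kappaPosRight κ₁ κ₂ c ∧ A₂ y c ≠ 0 := by
    intro y
    have h := hne (Fin.natAdd n₁ y)
    rcases eq_kappaPosLeft_or_eq_kappaPosRight κ₁ κ₂ (I (θ (Fin.natAdd n₁ y)))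
      with ⟨c, hc⟩ | ⟨c, hc⟩
    · rw [hc, kappaBlock_right_left] at h
      exact absurd rfl h
    · rw [hc, kappaBlock_right_right] at h
      exact ⟨c, hc, h⟩
  choose c₁ hc₁ hA₁ using hleft
  choose c₂ hc₂ hA₂ using hright
  refine ⟨c₁, c₂, θ, hA₁, hA₂, ?_, ?_, ?_⟩
  · intro x x' h
    have : I (θ (Fin.castAdd n₂ x)) = I (θ (Fin.castAdd n₂ x')) := by rw [hc₁, hc₁, h]
    exact Fin.castAdd_injective _ _ (θ.injective (I.injective this))
  · intro x x' h
    have : I (θ (Fin.natAdd n₁ x)) = I (θ (Fin.natAdd n₁ x')) := by rw [hc₂, hc₂, h]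
    exact Fin.natAdd_injective _ _ (θ.injective (I.injective this))
  · funext u
    induction u using Fin.addCases with
    | left x => simp [kappaPos, hc₁]
    | right y => simp [kappaPos, hc₂]

/-- The maximal minors of the `κ`-direct sum in terms of those of the summands. -/
theorem maximalMinor_kappaBlock_submatrix (hκ₁ : StrictMono κ₁) (hκ₂ : StrictMono κ₂)
    (hκ : ∀ i j, κ₁ i ≠ κ₂ j) (hp₁ : StrictMono p₁) (hp₂ : StrictMono p₂)
    {I : Fin (n₁ + n₂) ↪o Fin (m₁ + m₂)} {c₁ : Fin n₁ → Fin m₁} {c₂ : Fin n₂ → Fin m₂}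
    {θ : Equiv.Perm (Fin (n₁ + n₂))} (h : I ∘ θ = kappaPos κ₁ κ₂ c₁ c₂) :
    maximalMinor ((kappaBlock κ₁ κ₂ A₁ A₂).submatrix (pivotSort κ₁ κ₂ p₁ p₂) id) I
      = (ordSign (κ₁ ∘ c₁) * (A₁.submatrix id c₁).det)
        * (ordSign (κ₂ ∘ c₂) * (A₂.submatrix id c₂).det)
        * ((∏ x, ∏ y, ltSign (κ₁ (c₁ x)) (κ₂ (c₂ y)))
          * ∏ x, ∏ y, ltSign (κ₁ (p₁ x)) (κ₂ (p₂ y))) := by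
  have hS := kappaSorted_strictMono hκ₁ hκ₂ hκ
  have hI : (I : Fin (n₁ + n₂) → Fin (m₁ + m₂)) = kappaPos κ₁ κ₂ c₁ c₂ ∘ θ.symm := by
    rw [← h]
    funext u
    simp
  have hone : ∀ {n m : ℕ} {κ : Fin m → ℝ} {p : Fin n → Fin m}, StrictMono κ → StrictMono p →
      ordSign (κ ∘ p) = 1 := by
    intro n m κ p hκ hp
    rw [← sign_eq_ordSign (σ := 1) (by simpa using hκ.comp hp)]
    simp
  have h1 : ((Equiv.Perm.sign θ.symm : ℤ) : ℝ) = ordSign (Fin.append (κ₁ ∘ c₁) (κ₂ ∘ c₂)) := by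
    rw [← kappaSorted_comp_kappaPos]
    refine sign_eq_ordSign ?_
    rw [Function.comp_assoc, ← hI]
    exact hS.comp I.strictMono
  have h2 : (((pivotSort κ₁ κ₂ p₁ p₂).sign : ℤ) : ℝ)
      = ordSign (Fin.append (κ₁ ∘ p₁) (κ₂ ∘ p₂)) := by
    rw [← kappaSorted_comp_kappaPos]
    refine sign_eq_ordSign ?_
    rw [Function.comp_assoc]
    exact hS.comp (kappaPos_pivotSort_strictMono hp₁ hp₂)
  have h3 : maximalMinor ((kappaBlock κ₁ κ₂ A₁ A₂).submatrix (pivotSort κ₁ κ₂ p₁ p₂) id) I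
      = ((Equiv.Perm.sign θ.symm : ℤ) : ℝ) * ((((pivotSort κ₁ κ₂ p₁ p₂).sign : ℤ) : ℝ)
        * ((kappaBlock κ₁ κ₂ A₁ A₂).submatrix id (kappaPos κ₁ κ₂ c₁ c₂)).det) := by
    rw [← Matrix.det_permute, ← Matrix.det_permute', maximalMinor, hI]
    rfl
  rw [h3, h1, h2, det_kappaBlock_submatrix, ordSign_append, ordSign_append, hone hκ₁ hp₁,
    hone hκ₂ hp₂]
  simp only [Function.comp_apply]
  ring

end KappaBlock

theorem MemTNNGrassmannian.ordSign_mul_det_nonneg {n m : ℕ} {A : Matrix (Fin n) (Fin m) ℝ}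
    (hA : MemTNNGrassmannian A) {κ : Fin m → ℝ} (hκ : StrictMono κ) {c : Fin n → Fin m}
    (hc : Function.Injective c) : 0 ≤ ordSign (κ ∘ c) * (A.submatrix id c).det := by
  obtain ⟨I, hI⟩ := exists_det_submatrix_eq_ordSign_mul hκ hc
  rw [← hI]
  exact hA.2 I

/-- Conjugating by the signs `ε`, which leaves the pivots equal to `1`. -/
def signConj {n m : ℕ} (p : Fin n → Fin m) (ε : Fin m → ℝ) (A : Matrix (Fin n) (Fin m) ℝ) :
    Matrix (Fin n) (Fin m) ℝ :=
  Matrix.of fun i c => ε (p i) * ε c * A i c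

section SignConj

variable {n m : ℕ} {p : Fin n → Fin m} {ε : Fin m → ℝ} {A : Matrix (Fin n) (Fin m) ℝ}

theorem signConj_apply (i : Fin n) (c : Fin m) :
    signConj p ε A i c = ε (p i) * ε c * A i c := rfl

theorem signConj_eq_zero (i : Fin n) (c : Fin m) (h : A i c = 0) : signConj p ε A i c = 0 := by
  rw [signConj_apply, h, mul_zero]

theorem signConj_pivot (hε : ∀ c, ε c * ε c = 1)
    (hp : ∀ i i', A i (p i') = if i = i' then 1 else 0) (i i' : Fin n) :
    signConj p ε A i (p i') = if i = i' then 1 else 0 := by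
  rw [signConj_apply, hp]
  split_ifs with h
  · rw [h, hε, one_mul]
  · rw [mul_zero]

theorem abs_eq_one_of_mul_self {t : ℝ} (h : t * t = 1) : |t| = 1 := by
  rcases mul_self_eq_one_iff.1 h with rfl | rfl <;> simp

theorem isSignAdjustment_signConj (hε : ∀ c, ε c * ε c = 1) (hm : StrictMono p)
    (h0 : ∀ i j, j < p i → A i j = 0) (hp : ∀ i i', A i (p i') = if i = i' then 1 else 0) :
    IsSignAdjustment (signConj p ε A) A := by
  refine ⟨⟨p, hm, fun i j hj => signConj_eq_zero i j (h0 i j hj), signConj_pivot hε hp⟩, ?_⟩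
  intro i j
  rw [signConj_apply, abs_mul, abs_mul, abs_eq_one_of_mul_self (hε _),
    abs_eq_one_of_mul_self (hε _), one_mul, one_mul]

end SignConj

theorem tnnPerm_kappaDirectSum_signConj {n₁ m₁ n₂ m₂ : ℕ} {κ₁ : Fin m₁ → ℝ} {κ₂ : Fin m₂ → ℝ}
    (hκ₁ : StrictMono κ₁) (hκ₂ : StrictMono κ₂) (hκ : ∀ i j, κ₁ i ≠ κ₂ j)
    (A₁ : Matrix (Fin n₁) (Fin m₁) ℝ) (A₂ : Matrix (Fin n₂) (Fin m₂) ℝ)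
    (p₁ : Fin n₁ → Fin m₁) (p₂ : Fin n₂ → Fin m₂) {ε₁ : Fin m₁ → ℝ} {ε₂ : Fin m₂ → ℝ}
    (hε₁ : ∀ c, ε₁ c ≠ 0) (hε₂ : ∀ c, ε₂ c ≠ 0) :
    tnnPerm (kappaDirectSum κ₁ κ₂ (signConj p₁ ε₁ A₁) (signConj p₂ ε₂ A₂))
      = kappaPermProd κ₁ κ₂ (tnnPerm A₁) (tnnPerm A₂) := by
  obtain ⟨ρ, hρ⟩ : ∃ ρ : Equiv.Perm (Fin (n₁ + n₂)),
      kappaDirectSum κ₁ κ₂ (signConj p₁ ε₁ A₁) (signConj p₂ ε₂ A₂)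
        = (kappaBlock κ₁ κ₂ (signConj p₁ ε₁ A₁) (signConj p₂ ε₂ A₂)).submatrix ρ id := ⟨_, rfl⟩
  rw [hρ]
  have hsplit : ∀ u, (∃ x, ρ u = Fin.castAdd n₂ x) ∨ ∃ y, ρ u = Fin.natAdd n₁ y := by
    intro u
    induction ρ u using Fin.addCases with
    | left x => exact Or.inl ⟨x, rfl⟩
    | right y => exact Or.inr ⟨y, rfl⟩
  ext1 u
  rcases eq_kappaPosLeft_or_eq_kappaPosRight κ₁ κ₂ u with ⟨c, rfl⟩ | ⟨c, rfl⟩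
  · rw [kappaPermProd_kappaPosLeft]
    refine tnnPerm_of_block (r := fun x => ρ.symm (Fin.castAdd n₂ x))
      (ρ.symm.injective.comp (Fin.castAdd_injective _ _))
      (kappaPosLeft_strictMono hκ₁ hκ₂ hκ) (δ := fun x => ε₁ (p₁ x)) (fun x => hε₁ _) hε₁ ?_ ?_ ?_ c
    · intro x c
      rw [Matrix.submatrix_apply, Equiv.apply_symm_apply, id, kappaBlock_left_left, signConj_apply]
    · intro u c hu
      rw [Matrix.submatrix_apply, id]
      rcases hsplit u with ⟨x, hx⟩ | ⟨y, hy⟩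
      · exact absurd ⟨x, by simp [← hx]⟩ hu
      · rw [hy, kappaBlock_right_left]
    · intro x u hu
      rw [Matrix.submatrix_apply, Equiv.apply_symm_apply, id]
      rcases eq_kappaPosLeft_or_eq_kappaPosRight κ₁ κ₂ u with ⟨c, rfl⟩ | ⟨c, rfl⟩
      · exact absurd ⟨c, rfl⟩ hu
      · rw [kappaBlock_left_right]
  · rw [kappaPermProd_kappaPosRight]
    refine tnnPerm_of_block (r := fun y => ρ.symm (Fin.natAdd n₁ y))
      (ρ.symm.injective.comp (Fin.natAdd_injective _ _))
      (kappaPosRight_strictMono hκ₁ hκ₂ hκ) (δ := fun x => ε₂ (p₂ x)) (fun x => hε₂ _) hε₂ ?_ ?_ ?_ c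
    · intro x c
      rw [Matrix.submatrix_apply, Equiv.apply_symm_apply, id, kappaBlock_right_right,
        signConj_apply]
    · intro u c hu
      rw [Matrix.submatrix_apply, id]
      rcases hsplit u with ⟨x, hx⟩ | ⟨y, hy⟩
      · rw [hx, kappaBlock_left_right]
      · exact absurd ⟨y, by simp [← hy]⟩ hu
    · intro x u hu
      rw [Matrix.submatrix_apply, Equiv.apply_symm_apply, id]
      rcases eq_kappaPosLeft_or_eq_kappaPosRight κ₁ κ₂ u with ⟨c, rfl⟩ | ⟨c, rfl⟩
      · rw [kappaBlock_right_left]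
      · exact absurd ⟨c, rfl⟩ hu

theorem ltSign_mul_ltSign {a b b' : ℝ} (hab : a ≠ b) (hab' : a ≠ b') (hb : b ≤ b') :
    ltSign a b * ltSign a b' = if b < a ∧ a < b' then -1 else 1 := by
  rcases lt_or_gt_of_ne hab with h | h <;> rcases lt_or_gt_of_ne hab' with h' | h'
  · rw [ltSign_of_lt h, ltSign_of_lt h', if_neg (fun hc => absurd hc.1 h.not_gt), one_mul]
  · exact absurd (hb.trans_lt h') h.not_gt
  · rw [ltSign_of_gt h, ltSign_of_lt h', if_pos ⟨h, h'⟩, mul_one]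
  · rw [ltSign_of_gt h, ltSign_of_gt h', if_neg (fun hc => absurd hc.2 h'.not_gt), neg_mul_neg,
      one_mul]

theorem proposition3p5 {n₁ m₁ n₂ m₂ : ℕ}
    (κ₁ : Fin m₁ → ℝ) (κ₂ : Fin m₂ → ℝ)
    (hκ₁ : StrictMono κ₁) (hκ₂ : StrictMono κ₂) (hκ : ∀ i j, κ₁ i ≠ κ₂ j)
    (A₁ : Matrix (Fin n₁) (Fin m₁) ℝ) (A₂ : Matrix (Fin n₂) (Fin m₂) ℝ)
    (hA₁ : MemTNNGrassmannian A₁) (hA₂ : MemTNNGrassmannian A₂)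
    (hnc : NonCrossing κ₁ (tnnPerm A₁) κ₂ (tnnPerm A₂)) :
    ∃ (B₁ : Matrix (Fin n₁) (Fin m₁) ℝ) (B₂ : Matrix (Fin n₂) (Fin m₂) ℝ),
      IsSignAdjustment B₁ A₁ ∧ IsSignAdjustment B₂ A₂ ∧
      MemTNNGrassmannian (kappaDirectSum κ₁ κ₂ B₁ B₂) ∧
      tnnPerm (kappaDirectSum κ₁ κ₂ B₁ B₂)
        = kappaPermProd κ₁ κ₂ (tnnPerm A₁) (tnnPerm A₂) ∧
      (∀ I : Fin (n₁ + n₂) ↪o Fin (m₁ + m₂),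
        maximalMinor (kappaDirectSum κ₁ κ₂ B₁ B₂) I
          = |maximalMinor (kappaDirectSum κ₁ κ₂ A₁ A₂) I|) ∧
      (∀ C : Matrix (Fin (n₁ + n₂)) (Fin (m₁ + m₂)) ℝ, MemTNNGrassmannian C →
        (∀ I : Fin (n₁ + n₂) ↪o Fin (m₁ + m₂),
          |maximalMinor C I| = |maximalMinor (kappaDirectSum κ₁ κ₂ A₁ A₂) I|) →
        C = kappaDirectSum κ₁ κ₂ B₁ B₂) := by
  obtain ⟨p₁, hm₁, hz₁, hp₁⟩ := hA₁.1
  obtain ⟨p₂, hm₂, hz₂, hp₂⟩ := hA₂.1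
  set s : Fin m₁ → Fin m₂ → ℝ := fun c c' => ltSign (κ₁ c) (κ₂ c') with hs
  have hss : ∀ c c', s c c' * s c c' = 1 := fun c c' => ltSign_mul_self (hκ c c')
  set ε₁ : Fin m₁ → ℝ := fun c => ∏ y, s c (p₂ y) with hε₁
  set ε₂ : Fin m₂ → ℝ := fun c => ∏ x, s (p₁ x) c with hε₂
  have hsq₁ : ∀ c, ε₁ c * ε₁ c = 1 := fun c => by
    rw [hε₁, ← Finset.prod_mul_distrib]
    exact Finset.prod_eq_one fun y _ => hss _ _
  have hsq₂ : ∀ c, ε₂ c * ε₂ c = 1 := fun c => by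
    rw [hε₂, ← Finset.prod_mul_distrib]
    exact Finset.prod_eq_one fun y _ => hss _ _
  have hadj₁ := isSignAdjustment_signConj hsq₁ hm₁ hz₁ hp₁
  have hadj₂ := isSignAdjustment_signConj hsq₂ hm₂ hz₂ hp₂
  set B₁ := signConj p₁ ε₁ A₁ with hB₁
  set B₂ := signConj p₂ ε₂ A₂ with hB₂
  have hDA := kappaDirectSum_eq hκ₁ hκ₂ hκ hz₁ hz₂ hp₁ hp₂
  have hDB : kappaDirectSum κ₁ κ₂ B₁ B₂
      = (kappaBlock κ₁ κ₂ B₁ B₂).submatrix (pivotSort κ₁ κ₂ p₁ p₂) id :=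
    kappaDirectSum_eq hκ₁ hκ₂ hκ (fun i j hj => signConj_eq_zero i j (hz₁ i j hj))
      (fun i j hj => signConj_eq_zero i j (hz₂ i j hj)) (signConj_pivot hsq₁ hp₁)
      (signConj_pivot hsq₂ hp₂)
  have habs : ∀ I : Fin (n₁ + n₂) ↪o Fin (m₁ + m₂), |maximalMinor (kappaDirectSum κ₁ κ₂ B₁ B₂) I|
      = |maximalMinor (kappaDirectSum κ₁ κ₂ A₁ A₂) I| := by
    intro I
    set η : Fin (m₁ + m₂) → ℝ := Fin.append ε₁ ε₂ ∘ kappaSort κ₁ κ₂ with hη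
    have hηsq : ∀ u, |η u| = 1 := by
      intro u
      rw [hη, Function.comp_apply]
      induction kappaSort κ₁ κ₂ u using Fin.addCases with
      | left c => rw [Fin.append_left, abs_eq_one_of_mul_self (hsq₁ c)]
      | right c => rw [Fin.append_right, abs_eq_one_of_mul_self (hsq₂ c)]
    have hscale : ∀ i c, kappaDirectSum κ₁ κ₂ B₁ B₂ i c
        = η (kappaPos κ₁ κ₂ p₁ p₂ (pivotSort κ₁ κ₂ p₁ p₂ i)) * η c
          * kappaDirectSum κ₁ κ₂ A₁ A₂ i c := by
      intro i c
      rw [hDA, hDB, Matrix.submatrix_apply, Matrix.submatrix_apply]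
      generalize pivotSort κ₁ κ₂ p₁ p₂ i = u
      induction u using Fin.addCases <;>
        rcases eq_kappaPosLeft_or_eq_kappaPosRight κ₁ κ₂ c with ⟨c, rfl⟩ | ⟨c, rfl⟩ <;>
        simp [kappaBlock_left_left, kappaBlock_left_right, kappaBlock_right_left,
          kappaBlock_right_right, kappaPos, hη, kappaSort_kappaPosLeft, kappaSort_kappaPosRight,
          hB₁, hB₂, signConj_apply]
    rw [maximalMinor, maximalMinor, rescaled_minor hscale, abs_mul, abs_mul, Finset.abs_prod,
      Finset.abs_prod]
    simp only [hηsq, Finset.prod_const_one, one_mul]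
  have hnonneg : ∀ I : Fin (n₁ + n₂) ↪o Fin (m₁ + m₂),
      0 ≤ maximalMinor (kappaDirectSum κ₁ κ₂ B₁ B₂) I := by
    intro I
    by_cases h0 : maximalMinor (kappaDirectSum κ₁ κ₂ B₁ B₂) I = 0
    · exact h0.ge
    rw [hDB] at h0 ⊢
    obtain ⟨c₁, c₂, θ, hc₁, hc₂, hinj₁, hinj₂, hθ⟩ := exists_columns_of_maximalMinor_ne_zero h0
    have hA₁c : ∀ x, A₁ x (c₁ x) ≠ 0 := fun x h => hc₁ x (signConj_eq_zero _ _ h)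
    have hA₂c : ∀ y, A₂ y (c₂ y) ≠ 0 := fun y h => hc₂ y (signConj_eq_zero _ _ h)
    have hcell : ∀ x y, s (c₁ x) (p₂ y) * s (c₁ x) (c₂ y)
        = s (p₁ x) (p₂ y) * s (p₁ x) (c₂ y) := by
      intro x y
      have hle : κ₂ (p₂ y) ≤ κ₂ (c₂ y) :=
        hκ₂.monotone (not_lt.1 fun hlt => hA₂c y (hz₂ _ _ hlt))
      simp only [hs]
      rw [ltSign_mul_ltSign (hκ _ _) (hκ _ _) hle, ltSign_mul_ltSign (hκ _ _) (hκ _ _) hle]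
      simp only [pivot_between_iff_col_between hκ₁ hκ₂ hκ hnc hp₁ hp₂ (hA₁c x) (hA₂c y)]
    have hsign : (∏ x, ε₁ (p₁ x)) * (∏ x, ε₁ (c₁ x)) * ((∏ y, ε₂ (p₂ y)) * ∏ y, ε₂ (c₂ y))
        * ((∏ x, ∏ y, s (c₁ x) (c₂ y)) * ∏ x, ∏ y, s (p₁ x) (p₂ y)) = 1 := by
      simp only [hε₁, hε₂]
      rw [Finset.prod_comm (f := fun y x => s (p₁ x) (p₂ y)),
        Finset.prod_comm (f := fun y x => s (p₁ x) (c₂ y))]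
      simp only [← Finset.prod_mul_distrib]
      refine Finset.prod_eq_one fun x _ => Finset.prod_eq_one fun y _ => ?_
      linear_combination s (p₁ x) (p₂ y) * s (p₁ x) (p₂ y) * s (p₁ x) (c₂ y) * s (p₁ x) (p₂ y)
          * hcell x y
        + (s (p₁ x) (p₂ y) * s (p₁ x) (p₂ y) + 1) * hss (p₁ x) (p₂ y)
        + (s (p₁ x) (p₂ y)) ^ 4 * hss (p₁ x) (c₂ y)
    have hval := maximalMinor_kappaBlock_submatrix (A₁ := B₁) (A₂ := B₂) hκ₁ hκ₂ hκ hm₁ hm₂ hθ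
    rw [rescaled_minor (δ := fun x => ε₁ (p₁ x)) (fun i c => signConj_apply i c),
      rescaled_minor (δ := fun y => ε₂ (p₂ y)) (fun i c => signConj_apply i c)] at hval
    have hval' : maximalMinor ((kappaBlock κ₁ κ₂ B₁ B₂).submatrix (pivotSort κ₁ κ₂ p₁ p₂) id) I
        = (ordSign (κ₁ ∘ c₁) * (A₁.submatrix id c₁).det)
          * (ordSign (κ₂ ∘ c₂) * (A₂.submatrix id c₂).det) := by
      rw [hval]
      linear_combination (ordSign (κ₁ ∘ c₁) * (A₁.submatrix id c₁).det)
          * (ordSign (κ₂ ∘ c₂) * (A₂.submatrix id c₂).det) * hsign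
    rw [hval']
    exact mul_nonneg (hA₁.ordSign_mul_det_nonneg hκ₁ hinj₁)
      (hA₂.ordSign_mul_det_nonneg hκ₂ hinj₂)
  have hRREF := isRREF_kappaDirectSum hκ₁ hκ₂ hκ hadj₁.1 hadj₂.1
  refine ⟨B₁, B₂, hadj₁, hadj₂, ⟨hRREF, hnonneg⟩, ?_, ?_, ?_⟩
  · exact tnnPerm_kappaDirectSum_signConj hκ₁ hκ₂ hκ A₁ A₂ p₁ p₂
      (fun c h => by simpa [h] using hsq₁ c) (fun c h => by simpa [h] using hsq₂ c)
  · intro I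
    rw [← habs, abs_of_nonneg (hnonneg I)]
  · intro C hC hCI
    refine hC.1.eq_of_maximalMinor_eq hRREF fun I => ?_
    rw [← abs_of_nonneg (hC.2 I), hCI, ← habs, abs_of_nonneg (hnonneg I)]
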